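/- Let $\Omega\subset\mathbb{R}^2$ be a bounded, simply connected polygonal domain whose boundary $\Gamma$ is a simple closed polygon (consecutive edges may be collinear), with edges labelled as belonging to $\Gamma_c$, $\Gamma_s$ or $\Gamma_f$, not all to $\Gamma_f$. Let $t$ be the counterclockwise unit tangent and $n$ the outward unit normal on $\Gamma$. Let $\Gamma_{cs}^{(1)},\dots,\Gamma_{cs}^{(N)}$, $N\ge 1$, be the connected components of $\Gamma_{cs}=\overline{\Gamma_c}\cup\overline{\Gamma_s}$, numbered counterclockwise, and for $1\le i\le N-1$ let $\Gamma_f^{(i)}$ be the component of $\Gamma\setminus\Gamma_{cs}$ between $\Gamma_{cs}^{(i)}$ and $\Gamma_{cs}^{(i+1)}$. Write $(\cdot,\cdot)$ for the $L^2(\Omega)$ inner product of functions or vector fields, $\|\cdot\|_s$ for the norm of $H^s(\Omega)$ or $H^s(\Omega)^2$, $\operatorname{rot}\theta=\partial_x\theta_2-\partial_y\theta_1$; boundary values are traces. Put $$H^2_\Gamma(\Omega)=\{v\in H^2(\Omega): v|_{\Gamma_c\cup\Gamma_s}=0,\ \partial_n v|_{\Gamma_c}=0\},\qquad \Theta_\Gamma(\Omega)=\{\theta\in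 H^1(\Omega)^2:\theta|_{\Gamma_c}=0,\ t\cdot\theta|_{\Gamma_s}=0\}.$$ Let $a$ be a bilinear form on $H^1(\Omega)^2$ such that, for some constants $M,\alpha>0$, $|a(\theta,\psi)|\le M\|\theta\|_1\|\psi\|_1$ and $a(\theta,\theta)\ge0$ for all $\theta,\psi\in H^1(\Omega)^2$, and $a(\nabla u,\nabla u)\ge\alpha\|u\|_2^2$ for all $u\in H^2_\Gamma(\Omega)$. Let $\mathbb{W}\subseteq H^2(\Omega)$ be a linear subspace, let $\mathbb{G}_\Gamma\subseteq\Theta_\Gamma(\Omega)$ and $\tilde{\mathbb{W}}_\Gamma\subset H^1(\Omega)$ be finite-dimensional linear subspaces, and suppose that $\tilde{\mathbb{W}}_\Gamma$ contains no nonzero constant function (as is the case when its members vanish on $\Gamma_{cs}$). Put $\mathbb{W}_\Gamma=\mathbb{W}\cap H^2_\Gamma(\Omega)$ and $$\mathbb{V}_\Gamma=\{v\in\mathbb{W}: v|_{\Gamma_{cs}^{(1)}}=0,\ v|_{\Gamma_{cs}^{(i)}}\text{ is constant for }2\le i\le N,\ \partial_n v|_{\Gamma_c}=0\}.$$ Assume: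 (A1) for all $\mu_1,\dots,\mu_N\in\mathbb{R}$ there is $v\in\mathbb{W}$ with $v|_{\Gamma_{cs}^{(i)}}=\mu_i$ for $1\le i\le N$, $\partial_n v|_\Gamma=0$ and $\nabla v\in\mathbb{G}_\Gamma$; (A2) $\mathbb{W}_\Gamma\subseteq\tilde{\mathbb{W}}_\Gamma$; (A3) the sequence $0\to\mathbb{V}_\Gamma\xrightarrow{\nabla}\mathbb{G}_\Gamma\xrightarrow{\operatorname{rot}}\operatorname{rot}\mathbb{G}_\Gamma\to0$ is exact. Let $F$ be a linear functional on $H^2_\Gamma(\Omega)+\tilde{\mathbb{W}}_\Gamma$ that is bounded on $H^2_\Gamma(\Omega)$ in the norm $\|\cdot\|_2$. Then there is exactly one tuple $(\tilde z_X,\theta_X,r_X,\kappa,\tilde w_X)\in\tilde{\mathbb{W}}_\Gamma\times\mathbb{G}_\Gamma\times\operatorname{rot}\mathbb{G}_\Gamma\times\mathbb{R}^{N-1}\times\tilde{\mathbb{W}}_\Gamma$ such that 1. $(\nabla\tilde z_X,\nabla\tilde v)=F(\tilde v)$ for all $\tilde v\in\tilde{\mathbb{W}}_\Gamma$; 2.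 $a(\theta_X,\psi)+(\operatorname{rot}\psi,r_X)+\sum_{i=1}^{N-1}\kappa_i\int_{\Gamma_f^{(i)}}t\cdot\psi\,ds=(\nabla\tilde z_X,\psi)$ for all $\psi\in\mathbb{G}_\Gamma$, $(\operatorname{rot}\theta_X,s)=0$ for all $s\in\operatorname{rot}\mathbb{G}_\Gamma$, and $\sum_{i=1}^{N-1}\mu_i\int_{\Gamma_f^{(i)}}t\cdot\theta_X\,ds=0$ for all $\mu\in\mathbb{R}^{N-1}$; 3. $(\nabla\tilde w_X,\nabla v)=(\theta_X,\nabla v)$ for all $v\in\tilde{\mathbb{W}}_\Gamma$. Moreover, there is exactly one $w_X\in\mathbb{W}_\Gamma$ with $a(\nabla w_X,\nabla v)=F(v)$ for all $v\in\mathbb{W}_\Gamma$, and $\nabla\tilde w_X=\theta_X$ and $\tilde w_X=w_X$ (in particular $\tilde w_X\in\mathbb{W}_\Gamma$). -/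

import Mathlib

open MeasureTheory Set Topology
open scoped ContDiff

noncomputable section

/-- The Euclidean plane. -/
abbrev Plane : Type := EuclideanSpace ℝ (Fin 2)

/-- The `j`-th partial derivative of a (classically differentiable) function on the plane. -/
def classicalPartial (j : Fin 2) (φ : Plane → ℝ) (x : Plane) : ℝ :=
  fderiv ℝ φ x (EuclideanSpace.single j 1)

/-- The boundary condition prescribed on an edge of the plate. -/
inductive EdgeKind : Type
  | clamped
  | supported
  | free

/-- A bounded, simply connected polygonal domain in the plane, together with the partition of its
boundary edges into clamped, simply supported and free ones.

The boundary is one simple closed polygon with vertices `A₀, A₁, …, Aₙ₋₁` (indices modulo `n`);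
the `k`-th edge joins `Aₖ` to `Aₖ₊₁`.  Consecutive edges may be collinear.  The vertices are listed
counterclockwise, i.e. the domain lies to the left of every edge.  As a bounded component of the
complement of a Jordan curve, the domain is automatically simply connected. -/
structure PolygonalPlate : Type where
  /-- number of edges -/
  n : ℕ
  three_le : 3 ≤ n
  vertex : ZMod n → Plane
  /-- the domain `Ω` -/
  domain : Set Plane
  kind : ZMod n → EdgeKind
  vertex_injective : Function.Injective vertex
  /-- two consecutive edges meet only in their common vertex -/
  adjacent_edges : ∀ k : ZMod n,
    segment ℝ (vertex k) (vertex (k + 1)) ∩ segment ℝ (vertex (k + 1)) (vertex (k + 1 + 1))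
      = {vertex (k + 1)}
  /-- edges that are not consecutive are disjoint -/
  nonadjacent_edges : ∀ k l : ZMod n, l ≠ k → l ≠ k + 1 → k ≠ l + 1 →
    Disjoint (segment ℝ (vertex k) (vertex (k + 1))) (segment ℝ (vertex l) (vertex (l + 1)))
  isOpen : IsOpen domain
  isBounded : Bornology.IsBounded domain
  isConnected : IsConnected domain
  frontier_eq : frontier domain = ⋃ k : ZMod n, segment ℝ (vertex k) (vertex (k + 1))
  /-- the domain lies to the left of each edge -/
  left_side : ∀ k : ZMod n, ∀ x ∈ openSegment ℝ (vertex k) (vertex (k + 1)),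
    ∀ᶠ ε : ℝ in 𝓝[>] 0,
      x + ε • !₂[-(vertex (k + 1) 1 - vertex k 1), vertex (k + 1) 0 - vertex k 0] ∈ domain

namespace PolygonalPlate

variable (P : PolygonalPlate)

instance : NeZero P.n := ⟨by have := P.three_le; omega⟩

/-! ### Lebesgue and Sobolev spaces -/

/-- `L²(Ω)`. -/
abbrev L2 : Type := Lp ℝ 2 (volume.restrict P.domain)

/-- `g` is the weak partial derivative `∂ⱼ u` in `Ω`. -/
def IsWeakPartial (j : Fin 2) (u g : P.L2) : Prop :=
  ∀ φ : Plane → ℝ, ContDiff ℝ ∞ φ → HasCompactSupport φ → tsupport φ ⊆ P.domain →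
    ∫ x in P.domain, u x * classicalPartial j φ x = -∫ x in P.domain, g x * φ x

variable {P}

lemma memLp_of_test {φ : Plane → ℝ} (h : Continuous φ) (hc : HasCompactSupport φ) :
    MemLp φ 2 (volume.restrict P.domain) :=
  (h.memLp_of_hasCompactSupport hc).restrict _

lemma integrable_mul_test (u : P.L2) {φ : Plane → ℝ} (h : Continuous φ)
    (hc : HasCompactSupport φ) :
    Integrable (fun x => u x * φ x) (volume.restrict P.domain) :=
  (Lp.memLp u).integrable_mul (memLp_of_test h hc)

lemma continuous_classicalPartial (j : Fin 2) {φ : Plane → ℝ} (h : ContDiff ℝ ∞ φ) :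
    Continuous (classicalPartial j φ) :=
  (h.continuous_fderiv (by simp)).clm_apply continuous_const

lemma hasCompactSupport_classicalPartial (j : Fin 2) {φ : Plane → ℝ} (h : HasCompactSupport φ) :
    HasCompactSupport (classicalPartial j φ) :=
  h.fderiv_apply ℝ (EuclideanSpace.single j 1)

lemma integral_add_mul (u v : P.L2) {φ : Plane → ℝ} (h : Continuous φ)
    (hc : HasCompactSupport φ) :
    ∫ x in P.domain, (u + v : P.L2) x * φ x
      = (∫ x in P.domain, u x * φ x) + (∫ x in P.domain, v x * φ x) := by
  rw [← integral_add (integrable_mul_test u h hc) (integrable_mul_test v h hc)]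
  refine integral_congr_ae ?_
  filter_upwards [Lp.coeFn_add u v] with x hx
  rw [hx, Pi.add_apply, add_mul]

lemma integral_smul_mul (c : ℝ) (u : P.L2) (φ : Plane → ℝ) :
    ∫ x in P.domain, (c • u : P.L2) x * φ x = c * ∫ x in P.domain, u x * φ x := by
  rw [← integral_const_mul]
  refine integral_congr_ae ?_
  filter_upwards [Lp.coeFn_smul c u] with x hx
  rw [hx, Pi.smul_apply, smul_eq_mul, mul_assoc]

lemma IsWeakPartial.add {j : Fin 2} {u v g h : P.L2} (hu : P.IsWeakPartial j u g)
    (hv : P.IsWeakPartial j v h) : P.IsWeakPartial j (u + v) (g + h) := by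
  intro φ hφ hc hs
  rw [integral_add_mul u v (continuous_classicalPartial j hφ)
    (hasCompactSupport_classicalPartial j hc), integral_add_mul g h hφ.continuous hc,
    hu φ hφ hc hs, hv φ hφ hc hs]
  ring

lemma IsWeakPartial.smul {j : Fin 2} (c : ℝ) {u g : P.L2} (hu : P.IsWeakPartial j u g) :
    P.IsWeakPartial j (c • u) (c • g) := by
  intro φ hφ hc hs
  rw [integral_smul_mul, integral_smul_mul, hu φ hφ hc hs]
  ring

/-- Weak derivatives are unique. -/
lemma IsWeakPartial.unique {j : Fin 2} {u g h : P.L2} (hg : P.IsWeakPartial j u g)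
    (hh : P.IsWeakPartial j u h) : g = h := by
  have key : ∀ᵐ x ∂(volume : Measure Plane), x ∈ P.domain → (g x - h x) = 0 := by
    refine P.isOpen.ae_eq_zero_of_integral_contDiff_smul_eq_zero ?_ ?_
    · intro x hx
      obtain ⟨r, hr, hsub⟩ := Metric.isOpen_iff.1 P.isOpen x hx
      refine ⟨Metric.ball x r, mem_nhdsWithin_of_mem_nhds (Metric.ball_mem_nhds x hr), ?_⟩
      have hm : MemLp (fun x => g x - h x) 2 (volume.restrict (Metric.ball x r)) :=
        ((Lp.memLp g).sub (Lp.memLp h)).mono_measure (Measure.restrict_mono hsub le_rfl)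
      have : IsFiniteMeasure (volume.restrict (Metric.ball x r)) :=
        ⟨by rw [Measure.restrict_apply_univ]; exact measure_ball_lt_top⟩
      exact hm.integrable (by norm_num)
    · intro φ hφ hc hs
      have e : ∫ x in P.domain, g x * φ x = ∫ x in P.domain, h x * φ x := by
        have := (hg φ hφ hc hs).symm.trans (hh φ hφ hc hs)
        linarith
      have e1 : ∫ x, φ x • (g x - h x) = ∫ x in P.domain, φ x • (g x - h x) := by
        refine (setIntegral_eq_integral_of_forall_compl_eq_zero fun x hx => ?_).symm
        rw [image_eq_zero_of_notMem_tsupport fun h' => hx (hs h'), zero_smul]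
      rw [e1]
      have e2 : ∀ x, φ x • (g x - h x) = g x * φ x - h x * φ x := fun x => by
        rw [smul_eq_mul]; ring
      simp only [e2]
      rw [integral_sub (integrable_mul_test g hφ.continuous hc)
        (integrable_mul_test h hφ.continuous hc), e, sub_self]
  refine Lp.ext ?_
  rw [Filter.EventuallyEq, ae_restrict_iff' P.isOpen.measurableSet]
  filter_upwards [key] with x hx hxΩ
  exact sub_eq_zero.1 (hx hxΩ)

variable (P)

/-- `H¹(Ω)`: the functions in `L²(Ω)` whose weak first derivatives are in `L²(Ω)`. -/
def H1 : Submodule ℝ P.L2 where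
  carrier := {u | ∀ j : Fin 2, ∃ g : P.L2, P.IsWeakPartial j u g}
  add_mem' := fun hu hv j => by
    obtain ⟨g, hg⟩ := hu j
    obtain ⟨h, hh⟩ := hv j
    exact ⟨g + h, hg.add hh⟩
  zero_mem' := fun j => ⟨0, fun φ _ _ _ => by
    have h0 := Lp.coeFn_zero ℝ 2 (volume.restrict P.domain)
    have h1 : ∀ ψ : Plane → ℝ, ∫ x in P.domain, (0 : P.L2) x * ψ x = 0 := fun ψ =>
      integral_eq_zero_of_ae (by filter_upwards [h0] with x hx; rw [hx]; simp)
    rw [h1, h1, neg_zero]⟩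
  smul_mem' := fun c u hu j => by
    obtain ⟨g, hg⟩ := hu j
    exact ⟨c • g, hg.smul c⟩

/-- The weak partial derivative `∂ⱼ : H¹(Ω) → L²(Ω)`. -/
def partialD (j : Fin 2) : P.H1 →ₗ[ℝ] P.L2 where
  toFun u := (u.2 j).choose
  map_add' u v :=
    ((u + v).2 j).choose_spec.unique ((u.2 j).choose_spec.add (v.2 j).choose_spec)
  map_smul' c u := ((c • u).2 j).choose_spec.unique ((u.2 j).choose_spec.smul c)

lemma isWeakPartial_partialD (j : Fin 2) (u : P.H1) :
    P.IsWeakPartial j (u : P.L2) (P.partialD j u) := (u.2 j).choose_spec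

/-- Vector fields in `L²(Ω)²`. -/
abbrev L2v : Type := Fin 2 → P.L2

/-- Vector fields in `H¹(Ω)²`. -/
abbrev H1v : Type := Fin 2 → P.H1

/-- The gradient `H¹(Ω) → L²(Ω)²`. -/
def grad : P.H1 →ₗ[ℝ] P.L2v := LinearMap.pi P.partialD

/-- The scalar rotation `rot θ = ∂ₓ θ₂ - ∂_y θ₁`. -/
def rot : P.H1v →ₗ[ℝ] P.L2 :=
  P.partialD 0 ∘ₗ LinearMap.proj 1 - P.partialD 1 ∘ₗ LinearMap.proj 0

/-- `H²(Ω)`: the functions in `H¹(Ω)` whose first derivatives are in `H¹(Ω)`. -/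
def H2 : Submodule ℝ P.H1 where
  carrier := {u | ∀ j : Fin 2, P.partialD j u ∈ P.H1}
  add_mem' := fun hu hv j => by
    rw [map_add]; exact add_mem (hu j) (hv j)
  zero_mem' := fun j => by rw [map_zero]; exact zero_mem _
  smul_mem' := fun c u hu j => by
    rw [map_smul]; exact P.H1.smul_mem c (hu j)

/-- The gradient `H²(Ω) → H¹(Ω)²`. -/
def gradH2 : P.H2 →ₗ[ℝ] P.H1v where
  toFun u j := ⟨P.partialD j u, u.2 j⟩
  map_add' u v := by
    ext1 j; exact Subtype.ext (map_add (P.partialD j) (u : P.H1) (v : P.H1))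
  map_smul' c u := by
    ext1 j; exact Subtype.ext (map_smul (P.partialD j) c (u : P.H1))

variable {P}

/-- A field in `H¹(Ω)²` viewed in `L²(Ω)²`. -/
def toL2v (θ : P.H1v) : P.L2v := fun j => (θ j : P.L2)

/-- The inner product of `L²(Ω)²`. -/
def innerV (f g : P.L2v) : ℝ := ∑ j, inner ℝ (f j) (g j)

/-- The norm of `H¹(Ω)²`. -/
def normH1v (θ : P.H1v) : ℝ :=
  √(∑ j, (‖(θ j : P.L2)‖ ^ 2 + ∑ i, ‖P.partialD i (θ j)‖ ^ 2))

/-- The norm of `H²(Ω)`. -/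
def normH2 (u : P.H2) : ℝ :=
  √(‖((u : P.H1) : P.L2)‖ ^ 2 + ∑ j, ‖P.partialD j (u : P.H1)‖ ^ 2
    + ∑ j, ∑ i, ‖P.partialD i (P.gradH2 u j)‖ ^ 2)

/-! ### The boundary and traces -/

variable (P)

/-- Length of the `k`-th edge. -/
def edgeLength (k : ZMod P.n) : ℝ := dist (P.vertex k) (P.vertex (k + 1))

/-- Counterclockwise unit tangent on the `k`-th edge. -/
def tangent (k : ZMod P.n) : Plane :=
  (P.edgeLength k)⁻¹ • (P.vertex (k + 1) - P.vertex k)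

/-- Outward unit normal on the `k`-th edge. -/
def normal (k : ZMod P.n) : Plane := !₂[P.tangent k 1, -P.tangent k 0]

/-- Arc length measure on the `k`-th edge. -/
def edgeMeasure (k : ZMod P.n) : Measure Plane :=
  ENNReal.ofReal (P.edgeLength k) •
    Measure.map (fun t : ℝ => AffineMap.lineMap (P.vertex k) (P.vertex (k + 1)) t)
      (volume.restrict (Icc 0 1))

instance (k : ZMod P.n) : IsFiniteMeasure (P.edgeMeasure k) := by
  unfold edgeMeasure
  exact Measure.smul_finite _ ENNReal.ofReal_ne_top

variable {P}

/-- `g ∈ L²(∂Ω)` is the boundary trace of `u ∈ H¹(Ω)`: Green's formula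
`∫_Ω (u ∂ⱼφ + ∂ⱼu φ) dx = ∫_∂Ω g φ nⱼ ds` holds for all test functions `φ ∈ C_c^∞(ℝ²)`.
This determines `g` uniquely up to null sets of the boundary. -/
structure IsTrace (u : P.H1) (g : Plane → ℝ) : Prop where
  memLp : ∀ k, MemLp g 2 (P.edgeMeasure k)
  green : ∀ φ : Plane → ℝ, ContDiff ℝ ∞ φ → HasCompactSupport φ → ∀ j : Fin 2,
    (∫ x in P.domain, (u : P.L2) x * classicalPartial j φ x)
      + (∫ x in P.domain, P.partialD j u x * φ x)
      = ∑ k, P.normal k j * (∫ x, g x * φ x ∂(P.edgeMeasure k))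

lemma IsTrace.integrable {u : P.H1} {g : Plane → ℝ} (hg : IsTrace u g) {φ : Plane → ℝ}
    (hφ : Continuous φ) (hc : HasCompactSupport φ) (k : ZMod P.n) :
    Integrable (fun x => g x * φ x) (P.edgeMeasure k) :=
  MemLp.integrable_mul (p := 2) (q := 2) (hg.memLp k) (hφ.memLp_of_hasCompactSupport hc)

lemma IsTrace.add {u v : P.H1} {g h : Plane → ℝ} (hg : IsTrace u g) (hh : IsTrace v h) :
    IsTrace (u + v) (g + h) where
  memLp k := (hg.memLp k).add (hh.memLp k)
  green φ hφ hc j := by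
    have e : ∀ k, ∫ x, (g + h) x * φ x ∂(P.edgeMeasure k)
        = (∫ x, g x * φ x ∂(P.edgeMeasure k)) + (∫ x, h x * φ x ∂(P.edgeMeasure k)) := fun k => by
      rw [← integral_add (hg.integrable hφ.continuous hc k) (hh.integrable hφ.continuous hc k)]
      simp only [Pi.add_apply, add_mul]
    simp only [e, mul_add, Finset.sum_add_distrib]
    rw [← hg.green φ hφ hc j, ← hh.green φ hφ hc j, map_add, Submodule.coe_add,
      integral_add_mul _ _ (continuous_classicalPartial j hφ)
        (hasCompactSupport_classicalPartial j hc), integral_add_mul _ _ hφ.continuous hc]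
    ring

lemma IsTrace.smul (c : ℝ) {u : P.H1} {g : Plane → ℝ} (hg : IsTrace u g) :
    IsTrace (c • u) (c • g) where
  memLp k := (hg.memLp k).const_smul c
  green φ hφ hc j := by
    have e : ∀ k, ∫ x, (c • g) x * φ x ∂(P.edgeMeasure k)
        = c * ∫ x, g x * φ x ∂(P.edgeMeasure k) := fun k => by
      rw [← integral_const_mul]
      simp only [Pi.smul_apply, smul_eq_mul, mul_assoc]
    simp only [e, mul_left_comm _ c, ← Finset.mul_sum]
    rw [← hg.green φ hφ hc j, map_smul, Submodule.coe_smul, integral_smul_mul,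
      integral_smul_mul]
    ring

lemma IsTrace.zero : IsTrace (0 : P.H1) 0 := by
  have h0 := Lp.coeFn_zero ℝ 2 (volume.restrict P.domain)
  have h1 : ∀ ψ : Plane → ℝ, ∫ x in P.domain, (0 : P.L2) x * ψ x = 0 := fun ψ =>
    integral_eq_zero_of_ae (by filter_upwards [h0] with x hx; rw [hx]; simp)
  refine ⟨fun k => MemLp.zero, fun φ _ _ j => ?_⟩
  rw [map_zero, Submodule.coe_zero, h1, h1]
  simp

open Classical in
/-- The trace of `u` on the boundary (`0` by convention if there were none). -/
def trace (u : P.H1) : Plane → ℝ := if h : ∃ g, IsTrace u g then h.choose else 0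

/-- Trace of a vector field, componentwise. -/
def IsTraceV (θ : P.H1v) (g : Fin 2 → Plane → ℝ) : Prop := ∀ j, IsTrace (θ j) (g j)

lemma IsTraceV.add {θ ψ : P.H1v} {g h : Fin 2 → Plane → ℝ} (hg : IsTraceV θ g)
    (hh : IsTraceV ψ h) : IsTraceV (θ + ψ) (g + h) := fun j => (hg j).add (hh j)

lemma IsTraceV.smul (c : ℝ) {θ : P.H1v} {g : Fin 2 → Plane → ℝ} (hg : IsTraceV θ g) :
    IsTraceV (c • θ) (c • g) := fun j => (hg j).smul c

lemma IsTraceV.zero : IsTraceV (0 : P.H1v) 0 := fun _ => IsTrace.zero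

/-- The component `d · g` of a vector field `g` in the direction `d`. -/
def component (d : Plane) (g : Fin 2 → Plane → ℝ) (x : Plane) : ℝ := ∑ j, d j * g j x

lemma component_add (d : Plane) (g h : Fin 2 → Plane → ℝ) (x : Plane) :
    component d (g + h) x = component d g x + component d h x := by
  simp [component, mul_add, Finset.sum_add_distrib]

lemma component_smul (d : Plane) (c : ℝ) (g : Fin 2 → Plane → ℝ) (x : Plane) :
    component d (c • g) x = c * component d g x := by
  simp only [component, Pi.smul_apply, smul_eq_mul, Finset.mul_sum, mul_left_comm]

variable (P)

/-- `∫_{Γₖ} t · θ ds`, the tangential flux of `θ` through the `k`-th edge `Γₖ`. -/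
def edgeFlux (k : ZMod P.n) (θ : P.H1v) : ℝ :=
  ∫ x, component (P.tangent k) (fun j => trace (θ j)) x ∂(P.edgeMeasure k)

/-- `H²_Γ(Ω) = {v ∈ H²(Ω) : v = 0 on Γ_c ∪ Γ_s, ∂ₙ v = 0 on Γ_c}`. -/
def H2Γ : Submodule ℝ P.H2 where
  carrier := {v | ∃ (g : Plane → ℝ) (G : Fin 2 → Plane → ℝ),
    IsTrace (v : P.H1) g ∧ IsTraceV (P.gradH2 v) G ∧
    (∀ k, P.kind k ≠ .free → ∀ᵐ x ∂(P.edgeMeasure k), g x = 0) ∧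
    (∀ k, P.kind k = .clamped → ∀ᵐ x ∂(P.edgeMeasure k), component (P.normal k) G x = 0)}
  add_mem' := by
    rintro u v ⟨g, G, hg, hG, h1, h2⟩ ⟨g', G', hg', hG', h1', h2'⟩
    refine ⟨g + g', G + G', hg.add hg', ?_, fun k hk => ?_, fun k hk => ?_⟩
    · rw [map_add]; exact hG.add hG'
    · filter_upwards [h1 k hk, h1' k hk] with x hx hx'
      simp [hx, hx']
    · filter_upwards [h2 k hk, h2' k hk] with x hx hx'
      rw [component_add, hx, hx', add_zero]
  zero_mem' := by
    refine ⟨0, 0, IsTrace.zero, ?_, fun k _ => ?_, fun k _ => ?_⟩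
    · rw [map_zero]; exact IsTraceV.zero
    · simp
    · simp [component]
  smul_mem' := by
    rintro c u ⟨g, G, hg, hG, h1, h2⟩
    refine ⟨c • g, c • G, hg.smul c, ?_, fun k hk => ?_, fun k hk => ?_⟩
    · rw [map_smul]; exact hG.smul c
    · filter_upwards [h1 k hk] with x hx
      simp [hx]
    · filter_upwards [h2 k hk] with x hx
      rw [component_smul, hx, mul_zero]

/-- `Θ_Γ(Ω) = {θ ∈ H¹(Ω)² : θ = 0 on Γ_c, t · θ = 0 on Γ_s}`. -/
def ThetaΓ : Submodule ℝ P.H1v where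
  carrier := {θ | ∃ G : Fin 2 → Plane → ℝ, IsTraceV θ G ∧
    (∀ k, P.kind k = .clamped → ∀ j, ∀ᵐ x ∂(P.edgeMeasure k), G j x = 0) ∧
    (∀ k, P.kind k = .supported →
      ∀ᵐ x ∂(P.edgeMeasure k), component (P.tangent k) G x = 0)}
  add_mem' := by
    rintro u v ⟨G, hG, h1, h2⟩ ⟨G', hG', h1', h2'⟩
    refine ⟨G + G', hG.add hG', fun k hk j => ?_, fun k hk => ?_⟩
    · filter_upwards [h1 k hk j, h1' k hk j] with x hx hx'
      simp [hx, hx']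
    · filter_upwards [h2 k hk, h2' k hk] with x hx hx'
      rw [component_add, hx, hx', add_zero]
  zero_mem' := ⟨0, IsTraceV.zero, fun k _ j => by simp, fun k _ => by simp [component]⟩
  smul_mem' := by
    rintro c u ⟨G, hG, h1, h2⟩
    refine ⟨c • G, hG.smul c, fun k hk j => ?_, fun k hk => ?_⟩
    · filter_upwards [h1 k hk j] with x hx
      simp [hx]
    · filter_upwards [h2 k hk] with x hx
      rw [component_smul, hx, mul_zero]

/-! ### The connected components of `Γ_cs` and `Γ_f` -/

/-- The decomposition of the boundary into the `N = m + 1` connected components of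
`Γ_cs = closure Γ_c ∪ closure Γ_s` and the free arcs of `∂Ω \ Γ_cs` between them, numbered
counterclockwise.  The component `Γ_cs⁽ⁱ⁾` consists of the edges `start i, …, finish i - 1`, and the
component `Γ_f⁽ⁱ⁾` of the edges from `finish i` up to the one before the start of the next component
(edge numbers are read modulo `n`).  The last free arc may be empty only if `N = 1`, in which case
the whole boundary belongs to `Γ_cs`. -/
structure BoundaryArcs (m : ℕ) : Type where
  start : Fin (m + 1) → ℕ
  finish : Fin (m + 1) → ℕ
  start_lt_finish : ∀ i, start i < finish i
  finish_lt_start : ∀ i : Fin m, finish i.castSucc < start i.succ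
  finish_last_le : finish (Fin.last m) ≤ start 0 + P.n
  finish_last_lt : 0 < m → finish (Fin.last m) < start 0 + P.n
  kind_cs : ∀ i, ∀ k ∈ Finset.Ico (start i) (finish i), P.kind (k : ZMod P.n) ≠ .free
  kind_free : ∀ i : Fin m, ∀ k ∈ Finset.Ico (finish i.castSucc) (start i.succ),
    P.kind (k : ZMod P.n) = .free
  kind_free_last : ∀ k ∈ Finset.Ico (finish (Fin.last m)) (start 0 + P.n),
    P.kind (k : ZMod P.n) = .free

variable {P} {m : ℕ}

/-- `∫_{Γ_f⁽ⁱ⁾} t · θ ds`. -/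
def flux (B : P.BoundaryArcs m) (i : Fin m) (θ : P.H1v) : ℝ :=
  ∑ k ∈ Finset.Ico (B.finish i.castSucc) (B.start i.succ), P.edgeFlux (k : ZMod P.n) θ

/-- The boundary function `g` equals the constant `c` on `Γ_cs⁽ⁱ⁾`. -/
def EqConstOn (B : P.BoundaryArcs m) (i : Fin (m + 1)) (g : Plane → ℝ) (c : ℝ) : Prop :=
  ∀ k ∈ Finset.Ico (B.start i) (B.finish i), ∀ᵐ x ∂(P.edgeMeasure (k : ZMod P.n)), g x = c

/-- The space `𝕎_Γ = 𝕎 ∩ H²_Γ(Ω)`. -/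
def WΓ (W : Submodule ℝ P.H2) : Submodule ℝ P.H2 := W ⊓ P.H2Γ

/-- The space `𝕍_Γ` of all `v ∈ 𝕎` with `v = 0` on the first component of `Γ_cs`, `v` constant on
each of the other components, and `∂ₙ v = 0` on `Γ_c`. -/
def VΓ (B : P.BoundaryArcs m) (W : Submodule ℝ P.H2) : Submodule ℝ P.H2 where
  carrier := {v | v ∈ W ∧ ∃ (g : Plane → ℝ) (G : Fin 2 → Plane → ℝ),
    IsTrace (v : P.H1) g ∧ IsTraceV (P.gradH2 v) G ∧
    EqConstOn B 0 g 0 ∧ (∀ i, i ≠ 0 → ∃ c : ℝ, EqConstOn B i g c) ∧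
    (∀ k, P.kind k = .clamped → ∀ᵐ x ∂(P.edgeMeasure k), component (P.normal k) G x = 0)}
  add_mem' := by
    rintro u v ⟨hW, g, G, hg, hG, h1, h2, h3⟩ ⟨hW', g', G', hg', hG', h1', h2', h3'⟩
    refine ⟨W.add_mem hW hW', g + g', G + G', hg.add hg', ?_, fun k hk => ?_, fun i hi => ?_,
      fun k hk => ?_⟩
    · rw [map_add]; exact hG.add hG'
    · filter_upwards [h1 k hk, h1' k hk] with x hx hx'
      simp [hx, hx']
    · obtain ⟨c, hc⟩ := h2 i hi
      obtain ⟨c', hc'⟩ := h2' i hi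
      refine ⟨c + c', fun k hk => ?_⟩
      filter_upwards [hc k hk, hc' k hk] with x hx hx'
      simp [hx, hx']
    · filter_upwards [h3 k hk, h3' k hk] with x hx hx'
      rw [component_add, hx, hx', add_zero]
  zero_mem' := by
    refine ⟨W.zero_mem, 0, 0, IsTrace.zero, ?_, fun k _ => ?_, fun i _ => ⟨0, fun k _ => ?_⟩,
      fun k _ => ?_⟩
    · rw [map_zero]; exact IsTraceV.zero
    · simp
    · simp
    · simp [component]
  smul_mem' := by
    rintro c u ⟨hW, g, G, hg, hG, h1, h2, h3⟩
    refine ⟨W.smul_mem c hW, c • g, c • G, hg.smul c, ?_, fun k hk => ?_, fun i hi => ?_,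
      fun k hk => ?_⟩
    · rw [map_smul]; exact hG.smul c
    · filter_upwards [h1 k hk] with x hx
      simp [hx]
    · obtain ⟨d, hd⟩ := h2 i hi
      refine ⟨c * d, fun k hk => ?_⟩
      filter_upwards [hd k hk] with x hx
      simp [hx]
    · filter_upwards [h3 k hk] with x hx
      rw [component_smul, hx, mul_zero]

/-! ### The assumptions -/

/-- The bilinear form `a` is bounded and positive on `H¹(Ω)²` and coercive on `grad H²_Γ(Ω)`. -/
structure IsPlateForm (a : P.H1v →ₗ[ℝ] P.H1v →ₗ[ℝ] ℝ) : Prop where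
  bounded : ∃ M : ℝ, 0 < M ∧ ∀ θ ψ, |a θ ψ| ≤ M * normH1v θ * normH1v ψ
  nonneg : ∀ θ, 0 ≤ a θ θ
  coercive : ∃ α : ℝ, 0 < α ∧
    ∀ u ∈ P.H2Γ, α * normH2 u ^ 2 ≤ a (P.gradH2 u) (P.gradH2 u)

/-- (A1): for all reals `μᵢ` there is `v ∈ 𝕎` with `v = μᵢ` on `Γ_cs⁽ⁱ⁾` for every `i`,
`∂ₙ v = 0` on the whole boundary, and `grad v ∈ 𝔾_Γ`. -/
def AssumptionA1 (B : P.BoundaryArcs m) (W : Submodule ℝ P.H2) (G : Submodule ℝ P.H1v) : Prop :=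
  ∀ μ : Fin (m + 1) → ℝ, ∃ v ∈ W,
    (∃ g, IsTrace (v : P.H1) g ∧ ∀ i, EqConstOn B i g (μ i)) ∧
    (∃ D, IsTraceV (P.gradH2 v) D ∧
      ∀ k, ∀ᵐ x ∂(P.edgeMeasure k), component (P.normal k) D x = 0) ∧
    P.gradH2 v ∈ G

/-- (A2): `𝕎_Γ ⊆ 𝕎̃_Γ`, inside `H¹(Ω)`. -/
def AssumptionA2 (W : Submodule ℝ P.H2) (Wt : Submodule ℝ P.H1) : Prop :=
  ∀ v ∈ WΓ W, (v : P.H1) ∈ Wt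

/-- (A3): the sequence `0 → 𝕍_Γ → 𝔾_Γ → rot 𝔾_Γ → 0` with the maps `grad` and `rot` is exact, i.e.
`grad` is injective on `𝕍_Γ` and its range is the kernel of `rot` on `𝔾_Γ`.  (Exactness at
`rot 𝔾_Γ` is automatic.) -/
structure AssumptionA3 (B : P.BoundaryArcs m) (W : Submodule ℝ P.H2) (G : Submodule ℝ P.H1v) :
    Prop where
  grad_injective : ∀ v ∈ VΓ B W, P.gradH2 v = 0 → v = 0
  range_eq_ker : (VΓ B W).map P.gradH2 = G ⊓ LinearMap.ker P.rot

/-! ### The discrete problems -/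

variable (P) in
/-- The space `H²_Γ(Ω) + 𝕎̃_Γ` on which the load functional is defined. -/
def loadSpace (Wt : Submodule ℝ P.H1) : Submodule ℝ P.H1 := P.H2Γ.map P.H2.subtype ⊔ Wt

/-- The value of a load functional at `v ∈ H²_Γ(Ω)`. -/
def loadH2 {Wt : Submodule ℝ P.H1} (F : P.loadSpace Wt →ₗ[ℝ] ℝ) (v : P.H2Γ) : ℝ :=
  F ⟨((v : P.H2) : P.H1), Submodule.mem_sup_left (Submodule.mem_map_of_mem v.2)⟩

/-- The value of a load functional at `v ∈ 𝕎̃_Γ`. -/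
def loadWt {Wt : Submodule ℝ P.H1} (F : P.loadSpace Wt →ₗ[ℝ] ℝ) (v : Wt) : ℝ :=
  F ⟨(v : P.H1), Submodule.mem_sup_right v.2⟩

/-- `w` is the `H²`-conforming Galerkin approximation in `𝕎_Γ`:
`a(grad w, grad v) = F(v)` for all `v ∈ 𝕎_Γ`. -/
def IsGalerkin (a : P.H1v →ₗ[ℝ] P.H1v →ₗ[ℝ] ℝ) (W : Submodule ℝ P.H2) {Wt : Submodule ℝ P.H1}
    (F : P.loadSpace Wt →ₗ[ℝ] ℝ) (w : WΓ W) : Prop :=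
  ∀ v : WΓ W, a (P.gradH2 w) (P.gradH2 v) = loadH2 F ⟨v, v.2.2⟩

/-- The unknowns `(z̃, θ, r, κ, w̃)` of the three-step algorithm. -/
@[ext] structure AlgorithmOutput (m : ℕ) (G : Submodule ℝ P.H1v) (Wt : Submodule ℝ P.H1) :
    Type where
  z : Wt
  θ : G
  r : G.map P.rot
  κ : Fin m → ℝ
  w : Wt

/-- The equations of the three-step algorithm. -/
structure IsAlgorithmSolution (a : P.H1v →ₗ[ℝ] P.H1v →ₗ[ℝ] ℝ) (B : P.BoundaryArcs m)
    {G : Submodule ℝ P.H1v} {Wt : Submodule ℝ P.H1} (F : P.loadSpace Wt →ₗ[ℝ] ℝ)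
    (s : AlgorithmOutput m G Wt) : Prop where
  preprocess : ∀ v : Wt, innerV (P.grad s.z) (P.grad v) = loadWt F v
  stokes : ∀ ψ : G, a s.θ ψ + inner ℝ (P.rot ψ) (s.r : P.L2) + ∑ i, s.κ i * flux B i ψ
    = innerV (P.grad s.z) (toL2v (ψ : P.H1v))
  rot_free : ∀ q : G.map P.rot, inner ℝ (P.rot s.θ) (q : P.L2) = 0
  flux_free : ∀ μ : Fin m → ℝ, ∑ i, μ i * flux B i (s.θ : P.H1v) = 0
  postprocess : ∀ v : Wt, innerV (P.grad s.w) (P.grad v) = innerV (toL2v (s.θ : P.H1v)) (P.grad v)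

end PolygonalPlate

end

/-!
The saddle point problem of the second step is a constrained form of the Galerkin problem.  Let
`T θ = (rot θ, fluxes of θ through the free arcs)` for `θ ∈ 𝔾_Γ`.  The proof rests on three facts.

* The kernel of `T` is exactly `∇𝕎_Γ` (`constraint_gradH2`,
  `exists_gradH2_eq_of_constraint_eq_zero`).  By (A3) the rotation-free fields are the gradients of
  `𝕍_Γ`, and the flux of `∇v` through a free arc is the jump of `v` between the two neighbouring
  components of `Γ_cs` (`flux_gradH2`); if all fluxes vanish, the constants on the components all
  equal the value `0` on the first one.
* `T` maps onto `rot 𝔾_Γ × ℝᴺ⁻¹` (`constraint_surjective`): the functions of (A1) have rotation-free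
  gradients in `𝔾_Γ` with arbitrary fluxes.
* `a` is definite on `∇𝕎_Γ`, and `(∇·, ∇·)` is definite on `𝕎̃_Γ` (`eq_zero_of_innerV_grad`),
  because on a connected domain only constants have vanishing weak gradient
  (`ae_const_of_isWeakPartial_zero`).

Since everything is finite-dimensional, each of the three steps is uniquely solvable
(`LinearMap.existsUnique_of_definite`, `LinearMap.existsUnique_saddlePoint`).  Tested with `∇v`,
`v ∈ 𝕎_Γ`, the second step loses its multipliers and its right-hand side is `F v` by the first step,
so `θ_X = ∇w_X` (`IsAlgorithmSolution.eq_galerkin`).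

The flux formula has to be drawn from Green's formula alone, which is how traces are defined.
Traces are unique up to null sets (`IsTrace.ae_eq`), and combining Green's formula for `v` and for
`∇v` gives `∑ₖ ∫ (v ∂ₜφ + (t · ∇v) φ) ds = 0` over the closed polygon
(`sum_integral_tangential_eq_zero`); a cutoff function `φ` adapted to a free arc turns this into the
fundamental theorem of calculus along the arc.
-/

noncomputable section

namespace PolygonalPlate

variable {P : PolygonalPlate}

/-! ### Functions with vanishing weak gradient -/

lemma classicalPartial_comp_sub_left (j : Fin 2) {φ : Plane → ℝ} (hφ : ContDiff ℝ ∞ φ)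
    (x y : Plane) :
    classicalPartial j (fun z => φ (x - z)) y
      = -(fderiv ℝ φ (x - y) (EuclideanSpace.single j 1)) := by
  have h1 : HasFDerivAt φ (fderiv ℝ φ (x - y)) (x - y) :=
    (hφ.differentiable (by simp) _).hasFDerivAt
  have h2 : HasFDerivAt (fun z : Plane => x - z) (-ContinuousLinearMap.id ℝ Plane) y :=
    (hasFDerivAt_id y).const_sub x
  have h3 := (h1.comp y h2).fderiv
  unfold classicalPartial
  rw [show (fun z => φ (x - z)) = φ ∘ fun z => x - z from rfl, h3]
  simp

lemma clm_eq_zero_of_single {A : Plane →L[ℝ] ℝ}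
    (h : ∀ j : Fin 2, A (EuclideanSpace.single j 1) = 0) : A = 0 := by
  ext v
  have hv : v = ∑ j, v j • EuclideanSpace.single j (1 : ℝ) := by
    ext i; fin_cases i <;> simp
  rw [hv, map_sum]
  simp [h]

lemma locallyIntegrable_indicator (u : P.L2) :
    LocallyIntegrable (P.domain.indicator u) volume :=
  ((memLp_indicator_iff_restrict P.isOpen.measurableSet).2 (Lp.memLp u)).locallyIntegrable
    (by norm_num)

/-- The mollification of a function whose weak gradient vanishes has zero derivative at each point
whose distance to the boundary exceeds the mollification radius: differentiating the mollifier
tests the weak gradient against a reflected translate of the mollifier. -/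
lemma hasFDerivAt_mollification_zero {u : P.L2} (hu : ∀ j, P.IsWeakPartial j u 0)
    (φ : ContDiffBump (0 : Plane)) {x : Plane}
    (hx : Metric.closedBall x φ.rOut ⊆ P.domain) :
    HasFDerivAt (convolution (φ.normed volume) (P.domain.indicator u)
      (ContinuousLinearMap.lsmul ℝ ℝ : ℝ →L[ℝ] ℝ →L[ℝ] ℝ) volume) (0 : Plane →L[ℝ] ℝ) x := by
  rw [← convolution_flip]
  have hs : ContDiff ℝ ∞ (φ.normed volume) := φ.contDiff_normed
  have hc : HasCompactSupport (φ.normed volume) := φ.hasCompactSupport_normed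
  have h := hc.hasFDerivAt_convolution_right
    (ContinuousLinearMap.lsmul ℝ ℝ : ℝ →L[ℝ] ℝ →L[ℝ] ℝ).flip
    (locallyIntegrable_indicator u) (hs.of_le (by simp)) x
  refine h.congr_fderiv ?_
  refine clm_eq_zero_of_single fun j => ?_
  rw [convolution_precompR_apply _ (locallyIntegrable_indicator u) (hc.fderiv ℝ)
    (hs.continuous_fderiv (by simp)), convolution_def]
  have hts : tsupport (fun z => φ.normed volume (x - z)) ⊆ Metric.closedBall x φ.rOut := by
    refine closure_minimal (fun z hz => ?_) Metric.isClosed_closedBall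
    have : x - z ∈ tsupport (φ.normed volume) := subset_tsupport _ hz
    rw [φ.tsupport_normed_eq] at this
    simpa [dist_eq_norm, norm_sub_rev] using this
  have key := hu j (fun z => φ.normed volume (x - z)) (by fun_prop)
    (HasCompactSupport.of_support_subset_isCompact (isCompact_closedBall x φ.rOut)
      ((subset_tsupport _).trans hts)) (hts.trans hx)
  have h0 : ∫ y in P.domain, (0 : P.L2) y * φ.normed volume (x - y) = 0 :=
    integral_eq_zero_of_ae (by
      filter_upwards [Lp.coeFn_zero ℝ 2 (volume.restrict P.domain)] with y hy
      rw [hy]; simp)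
  rw [h0, neg_zero] at key
  simp only [classicalPartial_comp_sub_left j hs, mul_neg] at key
  rw [integral_neg, neg_eq_zero, ← integral_indicator P.isOpen.measurableSet] at key
  rw [← key]
  refine integral_congr_ae (Filter.Eventually.of_forall fun y => ?_)
  by_cases hy : y ∈ P.domain
  · simp [hy, mul_comm]
  · simp [hy]

lemma exists_ae_const_ball {u : P.L2} (hu : ∀ j, P.IsWeakPartial j u 0) {x : Plane}
    (hx : x ∈ P.domain) :
    ∃ r > 0, ∃ c : ℝ, Metric.ball x r ⊆ P.domain ∧ ∀ᵐ y, y ∈ Metric.ball x r → u y = c := by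
  obtain ⟨R, hR, hsub⟩ := Metric.isOpen_iff.1 P.isOpen x hx
  -- A bounded ratio of the two radii is what a.e. convergence of the mollifications requires.
  let φ : ℕ → ContDiffBump (0 : Plane) := fun n =>
    ⟨1 / ((n : ℝ) + 1), 2 * (1 / ((n : ℝ) + 1)), by positivity,
      by have : 0 < 1 / ((n : ℝ) + 1) := by positivity
         linarith⟩
  have hlim : Filter.Tendsto (fun n => (φ n).rOut) Filter.atTop (𝓝 0) := by
    have := (tendsto_one_div_add_atTop_nhds_zero_nat (𝕜 := ℝ)).const_mul 2
    rw [mul_zero] at this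
    exact this
  have hae := ContDiffBump.ae_convolution_tendsto_right_of_locallyIntegrable (K := 2) hlim
    (Filter.Eventually.of_forall fun n => le_rfl) (locallyIntegrable_indicator u)
  have hsmall : ∀ᶠ n in Filter.atTop, (φ n).rOut < R / 2 :=
    hlim.eventually (gt_mem_nhds (by positivity))
  set U : ℕ → Plane → ℝ := fun n => convolution ((φ n).normed volume) (P.domain.indicator u)
      (ContinuousLinearMap.lsmul ℝ ℝ : ℝ →L[ℝ] ℝ →L[ℝ] ℝ) volume with hU
  have hconst : ∀ᶠ n in Filter.atTop, ∀ y ∈ Metric.ball x (R / 2), U n y = U n x := by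
    filter_upwards [hsmall] with n hn y hy
    have hd : ∀ z ∈ Metric.ball x (R / 2), HasFDerivAt (U n) 0 z := fun z hz =>
      hasFDerivAt_mollification_zero hu (φ n) fun w hw => hsub (by
        simp only [Metric.mem_ball, Metric.mem_closedBall] at *
        linarith [dist_triangle w z x])
    exact Metric.isOpen_ball.is_const_of_fderiv_eq_zero (𝕜 := ℝ)
      (convex_ball x _).isPreconnected
      (fun z hz => (hd z hz).differentiableAt.differentiableWithinAt)
      (fun z hz => (hd z hz).fderiv) hy (Metric.mem_ball_self (by positivity))
  refine ⟨R / 2, by positivity, ?_⟩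
  have hball : Metric.ball x (R / 2) ⊆ P.domain :=
    (Metric.ball_subset_ball (by linarith)).trans hsub
  -- A single point of convergence identifies the limit of the constants `U n x`.
  have hex : ∃ y ∈ Metric.ball x (R / 2),
      Filter.Tendsto (fun n => U n y) Filter.atTop (𝓝 (P.domain.indicator u y)) := by
    by_contra! hno
    have hnull : volume (Metric.ball x (R / 2)) = 0 :=
      measure_mono_null (fun y hy => hno y hy) hae
    exact (Metric.measure_ball_pos volume x (by positivity : 0 < R / 2)).ne' hnull
  obtain ⟨y₀, hy₀, hlim₀⟩ := hex
  refine ⟨P.domain.indicator u y₀, hball, ?_⟩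
  filter_upwards [hae] with y hy hyb
  have h1 : Filter.Tendsto (fun n => U n y₀) Filter.atTop (𝓝 (P.domain.indicator u y)) := by
    refine hy.congr' ?_
    filter_upwards [hconst] with n hn
    exact (hn y hyb).trans (hn y₀ hy₀).symm
  have h2 := tendsto_nhds_unique h1 hlim₀
  rwa [indicator_of_mem (hball hyb)] at h2

/-- Since the domain is connected, a function with vanishing weak gradient is a.e. constant. -/
theorem ae_const_of_isWeakPartial_zero {u : P.L2} (hu : ∀ j, P.IsWeakPartial j u 0) :
    ∃ c : ℝ, ∀ᵐ x ∂(volume.restrict P.domain), u x = c := by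
  choose! r hr c hsub hc using fun x (hx : x ∈ P.domain) => exists_ae_const_ball hu hx
  have hcc : ∀ x ∈ P.domain, ∀ y ∈ P.domain, c x = c y := by
    intro x hx y hy
    refine P.isConnected.isPreconnected.induction₂ (fun x y => c x = c y) (fun x hx => ?_)
      (fun _ _ _ _ _ _ h h' => h.trans h') (fun _ _ _ _ h => h.symm) hx hy
    refine mem_nhdsWithin_of_mem_nhds ?_
    filter_upwards [Metric.ball_mem_nhds x (hr x hx)] with y hy
    have hyd := hsub x hx hy
    by_contra hne
    have hnull : volume (Metric.ball x (r x) ∩ Metric.ball y (r y)) = 0 := by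
      refine measure_mono_null (fun z hz => ?_) ((hc x hx).and (hc y hyd))
      rintro ⟨h1, h2⟩
      exact hne ((h1 hz.1).symm.trans (h2 hz.2))
    exact ((Metric.isOpen_ball.inter Metric.isOpen_ball).measure_pos volume
      ⟨y, hy, Metric.mem_ball_self (hr y hyd)⟩).ne' hnull
  obtain ⟨x₀, hx₀⟩ := P.isConnected.nonempty
  refine ⟨c x₀, ?_⟩
  rw [ae_restrict_iff' P.isOpen.measurableSet]
  refine measure_null_of_locally_null _ fun x hx => ?_
  have hxd : x ∈ P.domain := by
    by_contra h
    exact hx fun h' => absurd h' h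
  refine ⟨_, inter_mem_nhdsWithin _ (Metric.ball_mem_nhds x (hr x hxd)), ?_⟩
  refine measure_mono_null (fun y hy => ?_) (hc x hxd)
  exact fun h => hy.1 fun _ => (h hy.2).trans (hcc x hxd x₀ hx₀)

lemma ae_const_of_grad_eq_zero {u : P.H1} (hu : P.grad u = 0) :
    ∃ c : ℝ, ∀ᵐ x ∂(volume.restrict P.domain), (u : P.L2) x = c :=
  ae_const_of_isWeakPartial_zero fun j => by
    have h : P.partialD j u = 0 := congrFun hu j
    exact h ▸ P.isWeakPartial_partialD j u

end PolygonalPlate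

/-! ### Residues in an interval of natural numbers -/

lemma natCast_zmod_ne {n k l : ℕ} (h1 : k < l) (h2 : l < k + n) : (k : ZMod n) ≠ (l : ZMod n) := by
  intro h
  rw [ZMod.natCast_eq_natCast_iff, Nat.modEq_iff_dvd' h1.le] at h
  have := Nat.le_of_dvd (by omega) h
  omega

lemma injOn_natCast_zmod_Ico (n a : ℕ) :
    InjOn (fun k : ℕ => (k : ZMod n)) (Finset.Ico a (a + n)) := by
  intro k hk l hl h
  simp only [Finset.coe_Ico, mem_Ico] at hk hl
  rcases lt_trichotomy k l with hkl | hkl | hkl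
  · exact absurd h (natCast_zmod_ne hkl (by omega))
  · exact hkl
  · exact absurd h.symm (natCast_zmod_ne hkl (by omega))

lemma image_natCast_zmod_Ico (n a : ℕ) [NeZero n] :
    (Finset.Ico a (a + n)).image (fun k : ℕ => (k : ZMod n)) = Finset.univ := by
  rw [← Finset.card_eq_iff_eq_univ, Finset.card_image_of_injOn (injOn_natCast_zmod_Ico n a)]
  simp [ZMod.card]

lemma sum_zmod_eq_sum_Ico {n : ℕ} [NeZero n] (f : ZMod n → ℝ) (a : ℕ) :
    ∑ k, f k = ∑ k ∈ Finset.Ico a (a + n), f (k : ZMod n) := by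
  rw [← image_natCast_zmod_Ico n a, Finset.sum_image (injOn_natCast_zmod_Ico n a)]

namespace PolygonalPlate

variable {P : PolygonalPlate}

/-! ### The edges -/

lemma one_ne_zero_zmod : (1 : ZMod P.n) ≠ 0 := by
  have h : ((0 : ℕ) : ZMod P.n) ≠ ((1 : ℕ) : ZMod P.n) :=
    natCast_zmod_ne (by norm_num) (by have := P.three_le; omega)
  simpa using h.symm

lemma vertex_ne_succ (k : ZMod P.n) : P.vertex k ≠ P.vertex (k + 1) := fun h =>
  one_ne_zero_zmod (P := P) (by simpa using (P.vertex_injective h).symm)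

lemma edgeLength_pos (k : ZMod P.n) : 0 < P.edgeLength k := dist_pos.2 (vertex_ne_succ k)

lemma exists_normal_ne_zero (k : ZMod P.n) : ∃ j, P.normal k j ≠ 0 := by
  by_contra! h
  have h0 := h 0
  have h1 := h 1
  simp only [normal, PiLp.toLp_apply, Matrix.cons_val_zero, Matrix.cons_val_one,
    neg_eq_zero] at h0 h1
  have ht : P.tangent k = 0 := by
    ext j; fin_cases j
    · simpa using h1
    · simpa using h0
  rw [tangent, smul_eq_zero, sub_eq_zero] at ht
  rcases ht with ht | ht
  · exact (inv_pos.2 (edgeLength_pos k)).ne' ht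
  · exact vertex_ne_succ k ht.symm

lemma continuous_edgeMap (k : ZMod P.n) :
    Continuous fun t : ℝ => (AffineMap.lineMap (P.vertex k) (P.vertex (k + 1)) t : Plane) :=
  AffineMap.lineMap_continuous

lemma isClosed_edge (k : ZMod P.n) :
    IsClosed (segment ℝ (P.vertex k) (P.vertex (k + 1))) := by
  rw [segment_eq_image_lineMap]
  exact (isCompact_Icc.image (continuous_edgeMap k)).isClosed

lemma ae_edge_mem_segment (k : ZMod P.n) :
    ∀ᵐ x ∂(P.edgeMeasure k), x ∈ segment ℝ (P.vertex k) (P.vertex (k + 1)) := by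
  refine Measure.ae_smul_measure ?_ _
  refine (ae_map_iff (continuous_edgeMap k).measurable.aemeasurable
    (p := fun x => x ∈ segment ℝ (P.vertex k) (P.vertex (k + 1)))
    (isClosed_edge k).measurableSet).2 ?_
  filter_upwards [ae_restrict_mem measurableSet_Icc] with t ht
  rw [segment_eq_image_lineMap]
  exact mem_image_of_mem _ ht

lemma ae_edge_ne (k : ZMod P.n) (p : Plane) : ∀ᵐ x ∂(P.edgeMeasure k), x ≠ p := by
  refine Measure.ae_smul_measure ?_ _
  refine (ae_map_iff (continuous_edgeMap k).measurable.aemeasurable (p := fun x => x ≠ p)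
    (measurableSet_singleton p).compl).2 ?_
  refine ae_restrict_of_ae ?_
  have hsub : {t : ℝ |
      (AffineMap.lineMap (P.vertex k) (P.vertex (k + 1)) t : Plane) = p}.Subsingleton :=
    fun s hs t ht => AffineMap.lineMap_injective ℝ (vertex_ne_succ k) (hs.trans ht.symm)
  have hnull := hsub.measure_zero (volume : Measure ℝ)
  exact measure_mono_null (fun t ht => by simpa using ht) hnull

/-- Two different edges meet at most in an end point of the first. -/
lemma eq_vertex_of_mem_two_edges {k l : ZMod P.n} (hkl : l ≠ k) {x : Plane}
    (hk : x ∈ segment ℝ (P.vertex k) (P.vertex (k + 1)))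
    (hl : x ∈ segment ℝ (P.vertex l) (P.vertex (l + 1))) :
    x = P.vertex k ∨ x = P.vertex (k + 1) := by
  by_cases h1 : l = k + 1
  · subst h1
    have : x ∈ ({P.vertex (k + 1)} : Set Plane) := P.adjacent_edges k ▸ ⟨hk, hl⟩
    exact Or.inr this
  · by_cases h2 : k = l + 1
    · subst h2
      have : x ∈ ({P.vertex (l + 1)} : Set Plane) := P.adjacent_edges l ▸ ⟨hl, hk⟩
      exact Or.inl this
    · exact (Set.disjoint_left.1 (P.nonadjacent_edges k l hkl h1 h2) hk hl).elim

/-- The union of all edges except the `k`-th. -/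
def otherEdges (k : ZMod P.n) : Set Plane :=
  ⋃ l ∈ {l : ZMod P.n | l ≠ k}, segment ℝ (P.vertex l) (P.vertex (l + 1))

lemma isClosed_otherEdges (k : ZMod P.n) : IsClosed (otherEdges k) :=
  (Set.toFinite _).isClosed_biUnion fun l _ => isClosed_edge l

lemma ae_edge_notMem_otherEdges (k : ZMod P.n) :
    ∀ᵐ x ∂(P.edgeMeasure k), x ∈ (otherEdges k)ᶜ := by
  filter_upwards [ae_edge_mem_segment k, ae_edge_ne k (P.vertex k),
    ae_edge_ne k (P.vertex (k + 1))] with x hx h1 h2 hmem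
  simp only [otherEdges, mem_ofPred_eq, mem_iUnion, exists_prop] at hmem
  obtain ⟨l, hl, hxl⟩ := hmem
  exact (eq_vertex_of_mem_two_edges hl hx hxl).elim h1 h2

lemma fderiv_eq_sum_classicalPartial (φ : Plane → ℝ) (x v : Plane) :
    fderiv ℝ φ x v = ∑ j, v j * classicalPartial j φ x := by
  have hv : v = ∑ j, v j • EuclideanSpace.single j (1 : ℝ) := by
    ext i; fin_cases i <;> simp
  conv_lhs => rw [hv, map_sum]
  simp [classicalPartial]

/-- The fundamental theorem of calculus along an edge. -/
lemma integral_edge_tangential (k : ZMod P.n) {φ : Plane → ℝ} (hφ : ContDiff ℝ ∞ φ) :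
    ∫ x, component (P.tangent k) (fun j => classicalPartial j φ) x ∂(P.edgeMeasure k)
      = φ (P.vertex (k + 1)) - φ (P.vertex k) := by
  have hcont : Continuous (component (P.tangent k) fun j => classicalPartial j φ) :=
    continuous_finsetSum _ fun j _ => continuous_const.mul (continuous_classicalPartial j hφ)
  rw [edgeMeasure, integral_smul_measure, integral_map
    (continuous_edgeMap k).measurable.aemeasurable hcont.aestronglyMeasurable,
    integral_Icc_eq_integral_Ioc, ← intervalIntegral.integral_of_le zero_le_one,
    ENNReal.toReal_ofReal (edgeLength_pos k).le, smul_eq_mul,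
    ← intervalIntegral.integral_const_mul]
  have hder : ∀ t : ℝ, HasDerivAt
      (fun t : ℝ => φ (AffineMap.lineMap (P.vertex k) (P.vertex (k + 1)) t))
      (P.edgeLength k * component (P.tangent k) (fun j => classicalPartial j φ)
        (AffineMap.lineMap (P.vertex k) (P.vertex (k + 1)) t)) t := by
    intro t
    have h1 : HasFDerivAt φ _ (AffineMap.lineMap (P.vertex k) (P.vertex (k + 1)) t) :=
      (hφ.differentiable (by simp) _).hasFDerivAt
    have h2 : HasDerivAt
        (fun t : ℝ => (AffineMap.lineMap (P.vertex k) (P.vertex (k + 1)) t : Plane))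
        (P.vertex (k + 1) - P.vertex k) t := AffineMap.hasDerivAt_lineMap
    have h3 := h1.comp_hasDerivAt t h2
    refine h3.congr_deriv ?_
    rw [fderiv_eq_sum_classicalPartial, component, Finset.mul_sum]
    refine Finset.sum_congr rfl fun j _ => ?_
    simp only [tangent, PiLp.smul_apply, smul_eq_mul]
    rw [← mul_assoc, mul_inv_cancel_left₀ (edgeLength_pos k).ne']
  rw [intervalIntegral.integral_eq_sub_of_hasDerivAt (fun t _ => hder t)]
  · simp
  · exact (continuous_const.mul (hcont.comp (continuous_edgeMap k))).intervalIntegrable _ _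

/-! ### Uniqueness of traces -/

/-- A test function supported away from all other edges isolates the contribution of the `k`-th
edge to Green's formula, and some component of the normal of that edge does not vanish. -/
theorem IsTrace.ae_eq {u : P.H1} {g h : Plane → ℝ} (hg : IsTrace u g) (hh : IsTrace u h)
    (k : ZMod P.n) : ∀ᵐ x ∂(P.edgeMeasure k), g x = h x := by
  obtain ⟨j, hj⟩ := exists_normal_ne_zero k
  have hint : Integrable (fun x => g x - h x) (P.edgeMeasure k) :=
    ((hg.memLp k).sub (hh.memLp k)).integrable (by norm_num)
  have key := (isClosed_otherEdges k).isOpen_compl.ae_eq_zero_of_integral_contDiff_smul_eq_zero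
    (μ := P.edgeMeasure k) (f := fun x => g x - h x) (hint.locallyIntegrable.locallyIntegrableOn _)
    fun φ hφ hc hs => by
      have hother : ∀ f : Plane → ℝ, ∀ l, l ≠ k →
          ∫ x, f x * φ x ∂(P.edgeMeasure l) = 0 := fun f l hl => by
        refine integral_eq_zero_of_ae ?_
        filter_upwards [ae_edge_mem_segment l] with x hx
        have hx' : x ∉ tsupport φ := fun h' => hs h' (mem_biUnion (x := l) hl hx)
        simp [image_eq_zero_of_notMem_tsupport hx']
      have e1 := hg.green φ hφ hc j
      rw [hh.green φ hφ hc j,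
        Finset.sum_eq_single k (fun l _ hl => by rw [hother _ l hl, mul_zero]) (by simp),
        Finset.sum_eq_single k (fun l _ hl => by rw [hother _ l hl, mul_zero]) (by simp)] at e1
      have e2 := mul_left_cancel₀ hj e1
      have e3 : ∀ x, φ x • (g x - h x) = g x * φ x - h x * φ x := fun x => by
        rw [smul_eq_mul]; ring
      simp only [e3]
      rw [integral_sub (hg.integrable hφ.continuous hc k) (hh.integrable hφ.continuous hc k), e2,
        sub_self]
  filter_upwards [key, ae_edge_notMem_otherEdges k] with x hx hxo
  exact sub_eq_zero.1 (hx hxo)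

lemma IsTrace.trace_ae_eq {u : P.H1} {g : Plane → ℝ} (hg : IsTrace u g) (k : ZMod P.n) :
    ∀ᵐ x ∂(P.edgeMeasure k), trace u x = g x := by
  have hex : ∃ g, IsTrace u g := ⟨g, hg⟩
  have ht : IsTrace u (trace u) := by
    rw [trace, dif_pos hex]; exact hex.choose_spec
  exact ht.ae_eq hg k

lemma edgeFlux_eq {θ : P.H1v} {D : Fin 2 → Plane → ℝ} (hD : IsTraceV θ D) (k : ZMod P.n) :
    P.edgeFlux k θ = ∫ x, component (P.tangent k) D x ∂(P.edgeMeasure k) := by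
  refine integral_congr_ae ?_
  filter_upwards [(hD 0).trace_ae_eq k, (hD 1).trace_ae_eq k] with x h0 h1
  simp [component, h0, h1]

lemma IsTraceV.integrable_component {θ : P.H1v} {D : Fin 2 → Plane → ℝ} (hD : IsTraceV θ D)
    (d : Plane) (k : ZMod P.n) : Integrable (component d D) (P.edgeMeasure k) :=
  integrable_finsetSum _ fun j _ =>
    (((hD j).memLp k).integrable (by norm_num)).const_mul (d j)

lemma edgeFlux_add {θ ψ : P.H1v} {D E : Fin 2 → Plane → ℝ} (hD : IsTraceV θ D)
    (hE : IsTraceV ψ E) (k : ZMod P.n) :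
    P.edgeFlux k (θ + ψ) = P.edgeFlux k θ + P.edgeFlux k ψ := by
  rw [edgeFlux_eq hD, edgeFlux_eq hE, edgeFlux_eq (hD.add hE),
    ← integral_add (hD.integrable_component _ k) (hE.integrable_component _ k)]
  simp only [component_add]

lemma edgeFlux_smul (c : ℝ) {θ : P.H1v} {D : Fin 2 → Plane → ℝ} (hD : IsTraceV θ D)
    (k : ZMod P.n) : P.edgeFlux k (c • θ) = c * P.edgeFlux k θ := by
  rw [edgeFlux_eq hD, edgeFlux_eq (hD.smul c), ← integral_const_mul]
  simp only [component_smul]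

/-! ### Tangential derivatives of traces -/

lemma contDiff_classicalPartial (j : Fin 2) {φ : Plane → ℝ} (h : ContDiff ℝ ∞ φ) :
    ContDiff ℝ ∞ (classicalPartial j φ) :=
  (h.fderiv_right (by simp)).clm_apply contDiff_const

lemma tsupport_classicalPartial_subset (j : Fin 2) (φ : Plane → ℝ) :
    tsupport (classicalPartial j φ) ⊆ tsupport φ :=
  tsupport_fderiv_apply_subset ℝ _

lemma classicalPartial_comm {φ : Plane → ℝ} (h : ContDiff ℝ ∞ φ) (i j : Fin 2) (x : Plane) :
    classicalPartial i (classicalPartial j φ) x = classicalPartial j (classicalPartial i φ) x := by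
  have hd : DifferentiableAt ℝ (fderiv ℝ φ) x :=
    ((h.fderiv_right (m := ∞) (by simp)).differentiable (by simp)) x
  have e : ∀ i j : Fin 2, classicalPartial i (classicalPartial j φ) x
      = fderiv ℝ (fderiv ℝ φ) x (EuclideanSpace.single i 1) (EuclideanSpace.single j 1) := by
    intro i j
    have := (hd.hasFDerivAt.clm_apply
      (hasFDerivAt_const (EuclideanSpace.single j (1 : ℝ) : Plane) x)).fderiv
    change fderiv ℝ (fun y => fderiv ℝ φ y (EuclideanSpace.single j 1)) x _ = _
    rw [this]
    simp
  rw [e, e]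
  exact (h.contDiffAt.isSymmSndFDerivAt (by
    rw [minSmoothness_of_isRCLikeNormedField]
    exact WithTop.coe_le_coe.2 (le_top : (2 : ℕ∞) ≤ ⊤))).eq _ _

/-- Mixed weak second derivatives agree. -/
lemma partialD_gradH2_comm (v : P.H2) :
    P.partialD 0 (P.gradH2 v 1) = P.partialD 1 (P.gradH2 v 0) := by
  refine (P.isWeakPartial_partialD 0 (P.gradH2 v 1)).unique fun φ hφ hc hs => ?_
  have a0 := P.isWeakPartial_partialD 0 (v : P.H1) (classicalPartial 1 φ)
    (contDiff_classicalPartial 1 hφ) (hasCompactSupport_classicalPartial 1 hc)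
    ((tsupport_classicalPartial_subset 1 φ).trans hs)
  have a1 := P.isWeakPartial_partialD 1 (v : P.H1) (classicalPartial 0 φ)
    (contDiff_classicalPartial 0 hφ) (hasCompactSupport_classicalPartial 0 hc)
    ((tsupport_classicalPartial_subset 0 φ).trans hs)
  have a2 := P.isWeakPartial_partialD 1 (P.gradH2 v 0) φ hφ hc hs
  simp only [classicalPartial_comm hφ 0 1] at a0
  change ∫ x in P.domain, P.partialD 1 (v : P.H1) x * classicalPartial 0 φ x = _
  change ∫ x in P.domain, P.partialD 0 (v : P.H1) x * classicalPartial 1 φ x = _ at a2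
  linarith

lemma rot_gradH2 (v : P.H2) : P.rot (P.gradH2 v) = 0 := by
  change P.partialD 0 (P.gradH2 v 1) - P.partialD 1 (P.gradH2 v 0) = 0
  rw [partialD_gradH2_comm, sub_self]

/-- The tangential component of the trace of `∇v` is the distributional arc length derivative of
the trace of `v` along the whole closed polygon.  Green's formula is applied to `v` with the test
functions `∂₁φ`, `∂₀φ`, and to `∂₀v`, `∂₁v` with the test function `φ`. -/
theorem sum_integral_tangential_eq_zero {v : P.H2} {g : Plane → ℝ} {D : Fin 2 → Plane → ℝ}
    (hg : IsTrace (v : P.H1) g) (hD : IsTraceV (P.gradH2 v) D) {φ : Plane → ℝ}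
    (hφ : ContDiff ℝ ∞ φ) (hc : HasCompactSupport φ) :
    ∑ k, ((∫ x, g x * component (P.tangent k) (fun j => classicalPartial j φ) x
        ∂(P.edgeMeasure k))
      + ∫ x, component (P.tangent k) D x * φ x ∂(P.edgeMeasure k)) = 0 := by
  have g0 := hg.green _ (contDiff_classicalPartial 1 hφ)
    (hasCompactSupport_classicalPartial 1 hc) 0
  have g1 := hg.green _ (contDiff_classicalPartial 0 hφ)
    (hasCompactSupport_classicalPartial 0 hc) 1
  have d0 := (hD 0).green φ hφ hc 1
  have d1 := (hD 1).green φ hφ hc 0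
  simp only [classicalPartial_comm hφ 0 1] at g0
  rw [partialD_gradH2_comm] at d1
  change (∫ x in P.domain, P.partialD 0 (v : P.H1) x * classicalPartial 1 φ x) + _ = _ at d0
  change (∫ x in P.domain, P.partialD 1 (v : P.H1) x * classicalPartial 0 φ x) + _ = _ at d1
  have hn0 : ∀ k, P.normal k 0 = P.tangent k 1 := fun k => by simp [normal]
  have hn1 : ∀ k, P.normal k 1 = -P.tangent k 0 := fun k => by simp [normal]
  simp only [hn0, hn1, neg_mul, Finset.sum_neg_distrib] at g0 g1 d0 d1
  have e1 : ∀ k, ∫ x, g x * component (P.tangent k) (fun j => classicalPartial j φ) x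
        ∂(P.edgeMeasure k)
      = P.tangent k 0 * (∫ x, g x * classicalPartial 0 φ x ∂(P.edgeMeasure k))
        + P.tangent k 1 * (∫ x, g x * classicalPartial 1 φ x ∂(P.edgeMeasure k)) := fun k => by
    have i : ∀ j, Integrable (fun x => g x * classicalPartial j φ x) (P.edgeMeasure k) := fun j =>
      hg.integrable (continuous_classicalPartial j hφ) (hasCompactSupport_classicalPartial j hc) k
    rw [← integral_const_mul, ← integral_const_mul,
      ← integral_add ((i 0).const_mul _) ((i 1).const_mul _)]
    congr 1; ext x
    simp only [component, Fin.sum_univ_two]; ring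
  have e2 : ∀ k, ∫ x, component (P.tangent k) D x * φ x ∂(P.edgeMeasure k)
      = P.tangent k 0 * (∫ x, D 0 x * φ x ∂(P.edgeMeasure k))
        + P.tangent k 1 * (∫ x, D 1 x * φ x ∂(P.edgeMeasure k)) := fun k => by
    have i : ∀ j, Integrable (fun x => D j x * φ x) (P.edgeMeasure k) := fun j =>
      (hD j).integrable hφ.continuous hc k
    rw [← integral_const_mul, ← integral_const_mul,
      ← integral_add ((i 0).const_mul _) ((i 1).const_mul _)]
    congr 1; ext x
    simp only [component, Fin.sum_univ_two]; ring
  simp only [e1, e2, Finset.sum_add_distrib]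
  linarith

end PolygonalPlate

namespace PolygonalPlate

variable {P : PolygonalPlate} {m : ℕ}

/-! ### The flux of a gradient through a free arc -/

/-- Smooth compactly supported cutoff functions between disjoint compact sets. -/
lemma exists_cutoff {K₀ K₁ : Set Plane} (h₀ : IsCompact K₀) (h₁ : IsCompact K₁)
    (hd : Disjoint K₀ K₁) :
    ∃ φ : Plane → ℝ, ContDiff ℝ ∞ φ ∧ HasCompactSupport φ ∧ (∀ x ∈ K₀, φ =ᶠ[𝓝 x] fun _ => 0) ∧
      ∀ x ∈ K₁, φ =ᶠ[𝓝 x] fun _ => 1 := by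
  obtain ⟨R, hR⟩ := h₁.isBounded.subset_ball 0
  obtain ⟨f, hf0, hf1, -⟩ := exists_contMDiffMap_zero_one_nhds_of_isClosed (n := ⊤)
    (modelWithCornersSelf ℝ Plane) (s := K₀ ∪ (Metric.ball (0 : Plane) R)ᶜ) (t := K₁)
    (h₀.isClosed.union Metric.isOpen_ball.isClosed_compl) h₁.isClosed
    (disjoint_union_left.2 ⟨hd, disjoint_compl_left_iff_subset.2 hR⟩)
  refine ⟨f, f.contMDiff.contDiff, ?_, fun x hx => ?_, fun x hx => ?_⟩
  · refine HasCompactSupport.intro (isCompact_closedBall (0 : Plane) R) fun x hx => ?_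
    exact (mem_of_mem_nhds (Filter.eventually_iff.1 (eventually_nhdsSet_iff_forall.1 hf0 x
      (Or.inr fun h => hx (Metric.ball_subset_closedBall h)))) :)
  · exact eventually_nhdsSet_iff_forall.1 hf0 x (Or.inl hx)
  · exact eventually_nhdsSet_iff_forall.1 hf1 x hx

lemma component_classicalPartial_eq_zero {φ : Plane → ℝ} {x : Plane} {c : ℝ}
    (h : φ =ᶠ[𝓝 x] fun _ => c) (d : Plane) :
    component d (fun j => classicalPartial j φ) x = 0 := by
  have : fderiv ℝ φ x = 0 := by rw [h.fderiv_eq]; simp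
  simp [component, classicalPartial, this]

lemma isCompact_edge (k : ZMod P.n) :
    IsCompact (segment ℝ (P.vertex k) (P.vertex (k + 1))) := by
  rw [segment_eq_image_lineMap]
  exact isCompact_Icc.image (continuous_edgeMap k)

namespace BoundaryArcs

variable (B : P.BoundaryArcs m)

lemma monotone_start : Monotone B.start :=
  Fin.monotone_iff_le_succ.2 fun i =>
    ((B.start_lt_finish _).trans (B.finish_lt_start i)).le

lemma monotone_finish : Monotone B.finish :=
  Fin.monotone_iff_le_succ.2 fun i =>
    ((B.finish_lt_start i).trans (B.start_lt_finish _)).le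

/-- Every non-free edge belongs to one of the components of `Γ_cs`. -/
lemma exists_mem_Ico_of_ne_free {k : ZMod P.n} (hk : P.kind k ≠ .free) :
    ∃ i, ∃ l ∈ Finset.Ico (B.start i) (B.finish i), (l : ZMod P.n) = k := by
  have hmem : k ∈ (Finset.Ico (B.start 0) (B.start 0 + P.n)).image (fun l : ℕ => (l : ZMod P.n)) :=
    image_natCast_zmod_Ico P.n (B.start 0) ▸ Finset.mem_univ k
  obtain ⟨l, hl, rfl⟩ := Finset.mem_image.1 hmem
  rw [Finset.mem_Ico] at hl
  by_contra! hno
  have hnot : ∀ i, B.start i ≤ l → B.finish i ≤ l := fun i h => by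
    by_contra! h'
    exact hno i l (Finset.mem_Ico.2 ⟨h, h'⟩) rfl
  have hstart : ∀ i : Fin (m + 1), B.start i ≤ l := by
    intro i
    induction i using Fin.induction with
    | zero => exact hl.1
    | succ i ih =>
      by_contra! h
      exact hk (B.kind_free i l (Finset.mem_Ico.2 ⟨hnot _ ih, h⟩))
  exact hk (B.kind_free_last l (Finset.mem_Ico.2 ⟨hnot _ (hstart _), hl.2⟩))

end BoundaryArcs

lemma component_tangent_ae_eq_zero {D : Fin 2 → Plane → ℝ}
    (h1 : ∀ k, P.kind k = .clamped → ∀ j, ∀ᵐ x ∂(P.edgeMeasure k), D j x = 0)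
    (h2 : ∀ k, P.kind k = .supported →
      ∀ᵐ x ∂(P.edgeMeasure k), component (P.tangent k) D x = 0)
    {k : ZMod P.n} (hk : P.kind k ≠ .free) :
    ∀ᵐ x ∂(P.edgeMeasure k), component (P.tangent k) D x = 0 := by
  cases h : P.kind k with
  | clamped =>
    filter_upwards [h1 k h 0, h1 k h 1] with x h0 h1
    simp [component, h0, h1]
  | supported => exact h2 k h
  | free => exact absurd h hk

/-- The tangential flux of `∇v` through a free arc is the difference of the boundary values of `v`
on the two components of `Γ_cs` next to it.  The tangential integration by parts formula is applied
with a cutoff function that is `1` on the arc and decays to `0` along the two edges next to it, on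
which the trace of `v` is constant. -/
theorem flux_gradH2 (B : P.BoundaryArcs m) (i : Fin m) {v : P.H2} (hv : P.gradH2 v ∈ P.ThetaΓ)
    {g : Plane → ℝ} (hg : IsTrace (v : P.H1) g) {c c' : ℝ} (hc : EqConstOn B i.castSucc g c)
    (hc' : EqConstOn B i.succ g c') : flux B i (P.gradH2 v) = c' - c := by
  obtain ⟨D, hD, hD1, hD2⟩ := hv
  have hDt := fun k => component_tangent_ae_eq_zero hD1 hD2 (k := k)
  have hcs1 : B.finish i.castSucc - 1 ∈
      Finset.Ico (B.start i.castSucc) (B.finish i.castSucc) := by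
    have := B.start_lt_finish i.castSucc
    rw [Finset.mem_Ico]; omega
  have hcs2 : B.start i.succ ∈ Finset.Ico (B.start i.succ) (B.finish i.succ) :=
    Finset.left_mem_Ico.2 (B.start_lt_finish _)
  -- The arc consists of the edges `a + 1, …, s - 1`; its neighbours are the edges `a` and `s`.
  obtain ⟨a, ha⟩ : ∃ a, B.finish i.castSucc = a + 1 :=
    ⟨B.finish i.castSucc - 1, by have := B.start_lt_finish i.castSucc; omega⟩
  set s := B.start i.succ with hs
  have has : a + 1 < s := ha ▸ B.finish_lt_start i
  -- At least one edge is left over: the free arc after the last component.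
  have hsn : s + 1 < a + P.n := by
    have h1 := B.monotone_start (Fin.zero_le i.castSucc)
    have h2 := B.start_lt_finish i.castSucc
    have h3 := B.start_lt_finish i.succ
    have h4 := B.monotone_finish (Fin.le_last i.succ)
    have h5 := B.finish_last_lt (by have := i.2; omega)
    omega
  simp only [ha, Nat.add_sub_cancel] at hcs1
  let edge : ℕ → Set Plane := fun k =>
    segment ℝ (P.vertex (k : ZMod P.n)) (P.vertex ((k : ZMod P.n) + 1))
  have hdisj : Disjoint (⋃ k ∈ Finset.Ico (s + 1) (a + P.n), edge k)
      (⋃ k ∈ Finset.Ico (a + 1) s, edge k) := by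
    simp only [disjoint_iUnion_left, disjoint_iUnion_right, Finset.mem_Ico]
    rintro l hl k hk
    have e1 : (l : ZMod P.n) ≠ (k : ZMod P.n) := natCast_zmod_ne (by omega) (by omega)
    have e2 : ((l + 1 : ℕ) : ZMod P.n) ≠ (k : ZMod P.n) := natCast_zmod_ne (by omega) (by omega)
    have e3 : (l : ZMod P.n) ≠ ((k + 1 : ℕ) : ZMod P.n) := natCast_zmod_ne (by omega) (by omega)
    push_cast at e2 e3
    exact P.nonadjacent_edges _ _ e1 e3 e2.symm
  obtain ⟨φ, hφ, hφc, hφ0, hφ1⟩ := exists_cutoff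
    ((Finset.Ico (s + 1) (a + P.n)).finite_toSet.isCompact_biUnion
      fun k _ => isCompact_edge (k : ZMod P.n))
    ((Finset.Ico (a + 1) s).finite_toSet.isCompact_biUnion
      fun k _ => isCompact_edge (k : ZMod P.n)) hdisj
  have hφ0' : ∀ k ∈ Finset.Ico (s + 1) (a + P.n), ∀ x ∈ edge k, φ =ᶠ[𝓝 x] fun _ => 0 :=
    fun k hk x hx => hφ0 x (mem_biUnion (x := k) hk hx)
  have hφ1' : ∀ k ∈ Finset.Ico (a + 1) s, ∀ x ∈ edge k, φ =ᶠ[𝓝 x] fun _ => 1 :=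
    fun k hk x hx => hφ1 x (mem_biUnion (x := k) hk hx)
  have hcastadd : ∀ k : ℕ, (k : ZMod P.n) + 1 = ((k + 1 : ℕ) : ZMod P.n) := fun k => by
    push_cast; rfl
  have hva : φ (P.vertex (a : ZMod P.n)) = 0 := by
    have h := right_mem_segment ℝ (P.vertex ((a + P.n - 1 : ℕ) : ZMod P.n))
      (P.vertex (((a + P.n - 1 : ℕ) : ZMod P.n) + 1))
    have e : ((a + P.n - 1 : ℕ) : ZMod P.n) + 1 = a := by
      rw [hcastadd, Nat.sub_add_cancel (by omega)]; simp
    have h' := hφ0' (a + P.n - 1) (Finset.mem_Ico.2 (by omega)) _ h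
    rw [e] at h'
    exact h'.eq_of_nhds
  have hva1 : φ (P.vertex ((a : ZMod P.n) + 1)) = 1 := by
    rw [hcastadd]
    exact (hφ1' (a + 1) (Finset.mem_Ico.2 (by omega)) _ (left_mem_segment ℝ _ _)).eq_of_nhds
  have hvs : φ (P.vertex (s : ZMod P.n)) = 1 := by
    have h := right_mem_segment ℝ (P.vertex ((s - 1 : ℕ) : ZMod P.n))
      (P.vertex (((s - 1 : ℕ) : ZMod P.n) + 1))
    have e : ((s - 1 : ℕ) : ZMod P.n) + 1 = s := by
      rw [hcastadd, Nat.sub_add_cancel (by omega)]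
    have h' := hφ1' (s - 1) (Finset.mem_Ico.2 (by omega)) _ h
    rw [e] at h'
    exact h'.eq_of_nhds
  have hvs1 : φ (P.vertex ((s : ZMod P.n) + 1)) = 0 := by
    rw [hcastadd]
    exact (hφ0' (s + 1) (Finset.mem_Ico.2 (by omega)) _ (left_mem_segment ℝ _ _)).eq_of_nhds
  have hsum := sum_integral_tangential_eq_zero hg hD hφ hφc
  set T : ZMod P.n → ℝ := fun k =>
    (∫ x, g x * component (P.tangent k) (fun j => classicalPartial j φ) x ∂(P.edgeMeasure k))
      + ∫ x, component (P.tangent k) D x * φ x ∂(P.edgeMeasure k) with hT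
  have hTcs : ∀ (k : ZMod P.n) (b : ℝ), P.kind k ≠ .free →
      (∀ᵐ x ∂(P.edgeMeasure k), g x = b) →
      T k = b * (φ (P.vertex (k + 1)) - φ (P.vertex k)) := by
    intro k b hk hb
    have e1 : ∫ x, g x * component (P.tangent k) (fun j => classicalPartial j φ) x
        ∂(P.edgeMeasure k) = b * (φ (P.vertex (k + 1)) - φ (P.vertex k)) := by
      rw [← integral_edge_tangential k hφ, ← integral_const_mul]
      refine integral_congr_ae ?_
      filter_upwards [hb] with x hx
      rw [hx]
    have e2 : ∫ x, component (P.tangent k) D x * φ x ∂(P.edgeMeasure k) = 0 := by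
      refine integral_eq_zero_of_ae ?_
      filter_upwards [hDt k hk] with x hx
      simp [hx]
    simp only [hT, e1, e2, add_zero]
  have hT1 : T (a : ZMod P.n) = c := by
    rw [hTcs _ c (B.kind_cs i.castSucc a (ha ▸ hcs1)) (hc a (ha ▸ hcs1)), hva, hva1]; ring
  have hT2 : T (s : ZMod P.n) = -c' := by
    rw [hTcs _ c' (B.kind_cs i.succ s hcs2) (hc' s hcs2), hvs, hvs1]; ring
  have hTarc : ∀ k ∈ Finset.Ico (a + 1) s,
      T (k : ZMod P.n) = P.edgeFlux (k : ZMod P.n) (P.gradH2 v) := by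
    intro k hk
    rw [edgeFlux_eq hD]
    have e1 : ∫ x, g x * component (P.tangent k) (fun j => classicalPartial j φ) x
        ∂(P.edgeMeasure (k : ZMod P.n)) = 0 := by
      refine integral_eq_zero_of_ae ?_
      filter_upwards [ae_edge_mem_segment (k : ZMod P.n)] with x hx
      simp [component_classicalPartial_eq_zero (hφ1' k hk x hx)]
    have e2 : ∫ x, component (P.tangent k) D x * φ x ∂(P.edgeMeasure (k : ZMod P.n))
        = ∫ x, component (P.tangent k) D x ∂(P.edgeMeasure (k : ZMod P.n)) := by
      refine integral_congr_ae ?_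
      filter_upwards [ae_edge_mem_segment (k : ZMod P.n)] with x hx
      rw [(hφ1' k hk x hx).eq_of_nhds, mul_one]
    simp only [hT, e1, e2, zero_add]
  have hTrest : ∀ k ∈ Finset.Ico (s + 1) (a + P.n), T (k : ZMod P.n) = 0 := by
    intro k hk
    have e1 : ∫ x, g x * component (P.tangent k) (fun j => classicalPartial j φ) x
        ∂(P.edgeMeasure (k : ZMod P.n)) = 0 := by
      refine integral_eq_zero_of_ae ?_
      filter_upwards [ae_edge_mem_segment (k : ZMod P.n)] with x hx
      simp [component_classicalPartial_eq_zero (hφ0' k hk x hx)]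
    have e2 : ∫ x, component (P.tangent k) D x * φ x ∂(P.edgeMeasure (k : ZMod P.n)) = 0 := by
      refine integral_eq_zero_of_ae ?_
      filter_upwards [ae_edge_mem_segment (k : ZMod P.n)] with x hx
      simp [(hφ0' k hk x hx).eq_of_nhds]
    simp only [hT, e1, e2, zero_add]
  -- Summed from the edge `a` once around the polygon, the formula reads `c + flux - c' = 0`.
  rw [sum_zmod_eq_sum_Ico T a, Finset.sum_eq_sum_Ico_succ_bot (by omega),
    ← Finset.sum_Ico_consecutive _ (by omega : a + 1 ≤ s) (by omega : s ≤ a + P.n),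
    Finset.sum_eq_sum_Ico_succ_bot (by omega : s < a + P.n), Finset.sum_congr rfl hTarc,
    Finset.sum_eq_zero hTrest, hT1, hT2] at hsum
  rw [flux, ha]
  linarith

end PolygonalPlate

/-! ### Linear systems with definite and saddle point structure -/

/-- A form that is definite on a finite-dimensional space represents every functional. -/
lemma LinearMap.existsUnique_of_definite {V : Type*} [AddCommGroup V] [Module ℝ V]
    [FiniteDimensional ℝ V] (b : V →ₗ[ℝ] V →ₗ[ℝ] ℝ) (hb : ∀ v, b v v = 0 → v = 0)
    (f : V →ₗ[ℝ] ℝ) : ∃! u, ∀ v, b u v = f v := by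
  have hinj : Function.Injective (b : V →ₗ[ℝ] Module.Dual ℝ V) :=
    (injective_iff_map_eq_zero _).2 fun v hv => hb v (by rw [hv]; rfl)
  have hsurj := (LinearMap.injective_iff_surjective_of_finrank_eq_finrank
    (Subspace.dual_finrank_eq (K := ℝ) (V := V)).symm).1 hinj
  obtain ⟨u, hu⟩ := hsurj f
  exact ⟨u, fun v => by rw [hu], fun u' h => hinj (by rw [hu]; ext v; exact h v)⟩

/-- A saddle point problem is uniquely solvable if the constraint map is onto and the form is
definite on its kernel: the primal variable is determined on the kernel, and the residual functional
vanishes there, so it factors through the constraint map. -/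
lemma LinearMap.existsUnique_saddlePoint {V X : Type*} [AddCommGroup V] [Module ℝ V]
    [FiniteDimensional ℝ V] [AddCommGroup X] [Module ℝ X] [FiniteDimensional ℝ X]
    (a : V →ₗ[ℝ] V →ₗ[ℝ] ℝ) (T : V →ₗ[ℝ] X) (e : X →ₗ[ℝ] X →ₗ[ℝ] ℝ)
    (hT : Function.Surjective T) (ha : ∀ v, T v = 0 → a v v = 0 → v = 0)
    (he : ∀ x, e x x = 0 → x = 0) (f : V →ₗ[ℝ] ℝ) :
    ∃! p : V × X, (∀ ψ, a p.1 ψ + e p.2 (T ψ) = f ψ) ∧ T p.1 = 0 := by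
  obtain ⟨u, hu, huu⟩ := LinearMap.existsUnique_of_definite
    (V := LinearMap.ker T) (a.compl₁₂ (LinearMap.ker T).subtype (LinearMap.ker T).subtype)
    (fun v hv => Subtype.ext (ha v v.2 hv)) (f ∘ₗ (LinearMap.ker T).subtype)
  obtain ⟨S, hS⟩ := T.exists_rightInverse_of_surjective (LinearMap.range_eq_top.2 hT)
  have hS' : ∀ x, T (S x) = x := fun x => LinearMap.congr_fun hS x
  obtain ⟨x, hx, hxu⟩ := LinearMap.existsUnique_of_definite e he ((f - a u) ∘ₗ S)
  refine ⟨(u, x), ⟨fun ψ => ?_, u.2⟩, ?_⟩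
  · have h1 := hu ⟨ψ - S (T ψ), by simp [hS']⟩
    have h2 := hx (T ψ)
    simp only [LinearMap.compl₁₂_apply, Submodule.subtype_apply, map_sub,
      LinearMap.comp_apply, LinearMap.sub_apply] at h1 h2
    dsimp only
    linarith
  · rintro ⟨u', x'⟩ ⟨h1, h2⟩
    dsimp only at h1 h2
    have hu' : (⟨u', h2⟩ : LinearMap.ker T) = u := huu _ fun ψ => by
      have := h1 ψ
      rw [show T ψ = 0 from ψ.2, map_zero, add_zero] at this
      exact this
    have hu'' : u' = u := congrArg Subtype.val hu'
    subst hu''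
    refine Prod.ext rfl (hxu _ fun y => ?_)
    have := h1 (S y)
    rw [hS'] at this
    simp only [LinearMap.comp_apply, LinearMap.sub_apply]
    linarith

namespace PolygonalPlate

variable {P : PolygonalPlate} {m : ℕ}

/-! ### Definiteness of the forms -/

/-- The inner product of `L²(Ω)²` as a bilinear form. -/
def innerVₗ : P.L2v →ₗ[ℝ] P.L2v →ₗ[ℝ] ℝ :=
  LinearMap.mk₂ ℝ innerV
    (fun f f' g => by simp [innerV, inner_add_left, Finset.sum_add_distrib])
    (fun c f g => by simp only [innerV, Pi.smul_apply, real_inner_smul_left, Finset.mul_sum,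
      smul_eq_mul])
    (fun f g g' => by simp [innerV, inner_add_right, Finset.sum_add_distrib])
    (fun c f g => by simp only [innerV, Pi.smul_apply, real_inner_smul_right, Finset.mul_sum,
      smul_eq_mul])

lemma innerVₗ_apply (f g : P.L2v) : innerVₗ f g = innerV f g := rfl

lemma eq_zero_of_innerV_self {f : P.L2v} (h : innerV f f = 0) : f = 0 := by
  funext j
  have h' := (Finset.sum_eq_zero_iff_of_nonneg fun j _ => real_inner_self_nonneg).1 h j
    (Finset.mem_univ j)
  exact inner_self_eq_zero.1 h'

/-- `toL2v` as a linear map. -/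
def toL2vₗ : P.H1v →ₗ[ℝ] P.L2v where
  toFun := toL2v
  map_add' _ _ := rfl
  map_smul' _ _ := rfl

lemma toL2v_gradH2 (v : P.H2) : toL2v (P.gradH2 v) = P.grad (v : P.H1) := rfl

/-- A space of functions without nonzero constants is normed by the gradient. -/
lemma eq_zero_of_innerV_grad {Wt : Submodule ℝ P.H1}
    (hWt : ∀ v ∈ Wt, ∀ c : ℝ,
      (∀ᵐ x ∂(volume.restrict P.domain), (v : P.L2) x = c) → c = 0)
    (v : Wt) (h : innerV (P.grad v) (P.grad v) = 0) : v = 0 := by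
  obtain ⟨c, hc⟩ := ae_const_of_grad_eq_zero (eq_zero_of_innerV_self h)
  obtain rfl := hWt v v.2 c hc
  refine Subtype.ext (Subtype.ext (Lp.ext ?_))
  filter_upwards [hc, Lp.coeFn_zero ℝ 2 (volume.restrict P.domain)] with x h1 h2
  exact h1.trans h2.symm

lemma norm_le_normH2 (u : P.H2) : ‖((u : P.H1) : P.L2)‖ ≤ normH2 u := by
  have h1 : 0 ≤ ∑ j, ‖P.partialD j (u : P.H1)‖ ^ 2 := Finset.sum_nonneg fun _ _ => sq_nonneg _
  have h2 : 0 ≤ ∑ j, ∑ i, ‖P.partialD i (P.gradH2 u j)‖ ^ 2 :=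
    Finset.sum_nonneg fun _ _ => Finset.sum_nonneg fun _ _ => sq_nonneg _
  exact Real.le_sqrt_of_sq_le (by linarith)

lemma eq_zero_of_normH2 {u : P.H2} (h : normH2 u = 0) : u = 0 :=
  Subtype.ext (Subtype.ext (norm_le_zero_iff.1 (h ▸ norm_le_normH2 u)))

lemma IsPlateForm.eq_zero {a : P.H1v →ₗ[ℝ] P.H1v →ₗ[ℝ] ℝ} (ha : IsPlateForm a) {u : P.H2}
    (hu : u ∈ P.H2Γ) (h : a (P.gradH2 u) (P.gradH2 u) = 0) : u = 0 := by
  obtain ⟨α, hα, hc⟩ := ha.coercive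
  have h1 := hc u hu
  rw [h] at h1
  refine eq_zero_of_normH2 (pow_eq_zero_iff two_ne_zero |>.1 (le_antisymm ?_ (sq_nonneg _)))
  exact nonpos_of_mul_nonpos_right h1 hα

/-! ### The constraint map -/

lemma exists_isTraceV {θ : P.H1v} (h : θ ∈ P.ThetaΓ) : ∃ D, IsTraceV θ D := h.imp fun _ h => h.1

/-- The fluxes through the free arcs as a linear map. -/
def fluxₗ (B : P.BoundaryArcs m) {G : Submodule ℝ P.H1v} (hG : G ≤ P.ThetaΓ) :
    G →ₗ[ℝ] (Fin m → ℝ) where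
  toFun θ i := flux B i (θ : P.H1v)
  map_add' θ ψ := by
    obtain ⟨D, hD⟩ := exists_isTraceV (hG θ.2)
    obtain ⟨E, hE⟩ := exists_isTraceV (hG ψ.2)
    funext i
    simp only [flux, Submodule.coe_add, Pi.add_apply, edgeFlux_add hD hE, Finset.sum_add_distrib]
  map_smul' c θ := by
    obtain ⟨D, hD⟩ := exists_isTraceV (hG θ.2)
    funext i
    simp only [flux, Submodule.coe_smul, Pi.smul_apply, edgeFlux_smul c hD, Finset.mul_sum,
      smul_eq_mul, RingHom.id_apply]

/-- The constraint map `θ ↦ (rot θ, fluxes of θ)` of the saddle point problem. -/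
def constraint (B : P.BoundaryArcs m) {G : Submodule ℝ P.H1v} (hG : G ≤ P.ThetaΓ) :
    G →ₗ[ℝ] G.map P.rot × (Fin m → ℝ) :=
  (P.rot.submoduleMap G).prod (fluxₗ B hG)

lemma constraint_eq_zero_iff (B : P.BoundaryArcs m) {G : Submodule ℝ P.H1v} (hG : G ≤ P.ThetaΓ)
    (θ : G) : constraint B hG θ = 0 ↔ P.rot θ = 0 ∧ ∀ i, flux B i (θ : P.H1v) = 0 := by
  rw [Prod.ext_iff, Subtype.ext_iff, funext_iff]
  rfl

/-- The pairing of the multipliers `(r, κ)` with the constraints. -/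
def multiplierForm (G : Submodule ℝ P.H1v) (m : ℕ) :
    G.map P.rot × (Fin m → ℝ) →ₗ[ℝ] G.map P.rot × (Fin m → ℝ) →ₗ[ℝ] ℝ :=
  LinearMap.mk₂ ℝ (fun x y => inner ℝ (y.1 : P.L2) (x.1 : P.L2) + ∑ i, x.2 i * y.2 i)
    (fun x x' y => by
      simp only [Prod.fst_add, Prod.snd_add, Submodule.coe_add, inner_add_right, Pi.add_apply,
        add_mul, Finset.sum_add_distrib]
      ring)
    (fun c x y => by
      simp only [Prod.smul_fst, Prod.smul_snd, Submodule.coe_smul, real_inner_smul_right,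
        Pi.smul_apply, smul_eq_mul, mul_add, Finset.mul_sum, mul_assoc])
    (fun x y y' => by
      simp only [Prod.fst_add, Prod.snd_add, Submodule.coe_add, inner_add_left, Pi.add_apply,
        mul_add, Finset.sum_add_distrib]
      ring)
    (fun c x y => by
      simp only [Prod.smul_fst, Prod.smul_snd, Submodule.coe_smul, real_inner_smul_left,
        Pi.smul_apply, smul_eq_mul, mul_add, Finset.mul_sum, mul_left_comm])

lemma multiplierForm_apply {G : Submodule ℝ P.H1v} (x y : G.map P.rot × (Fin m → ℝ)) :
    multiplierForm G m x y = inner ℝ (y.1 : P.L2) (x.1 : P.L2) + ∑ i, x.2 i * y.2 i := rfl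

lemma multiplierForm_definite {G : Submodule ℝ P.H1v} (x : G.map P.rot × (Fin m → ℝ))
    (h : multiplierForm G m x x = 0) : x = 0 := by
  rw [multiplierForm_apply] at h
  have h1 : 0 ≤ inner ℝ (x.1 : P.L2) (x.1 : P.L2) := real_inner_self_nonneg
  have h2 : 0 ≤ ∑ i, x.2 i * x.2 i := Finset.sum_nonneg fun _ _ => mul_self_nonneg _
  have h4 : inner ℝ (x.1 : P.L2) (x.1 : P.L2) = 0 := by linarith
  refine Prod.ext (Subtype.ext (inner_self_eq_zero.1 h4)) (funext fun i => ?_)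
  have h3 := (Finset.sum_eq_zero_iff_of_nonneg fun i _ => mul_self_nonneg (x.2 i)).1
    (by linarith : ∑ i, x.2 i * x.2 i = 0) i (Finset.mem_univ i)
  exact mul_self_eq_zero.1 h3

variable {B : P.BoundaryArcs m} {W : Submodule ℝ P.H2} {G : Submodule ℝ P.H1v}

/-- The rotations alone are attained by definition, and the gradients provided by (A1) realize all
fluxes without changing the rotation. -/
lemma constraint_surjective (hG : G ≤ P.ThetaΓ) (hA1 : AssumptionA1 B W G) :
    Function.Surjective (constraint B hG) := by
  rintro ⟨⟨q, θ, hθ, rfl⟩, μ⟩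
  obtain ⟨v, -, ⟨g, hg, hgB⟩, -, hvG⟩ :=
    hA1 (Fin.partialSum fun i => μ i - flux B i θ)
  refine ⟨⟨θ, hθ⟩ + ⟨P.gradH2 v, hvG⟩, ?_⟩
  rw [map_add]
  refine Prod.ext (Subtype.ext ?_) (funext fun i => ?_)
  · change P.rot θ + P.rot (P.gradH2 v) = P.rot θ
    rw [rot_gradH2, add_zero]
  · change flux B i θ + flux B i (P.gradH2 v) = μ i
    rw [flux_gradH2 B i (hG hvG) hg (hgB _) (hgB _), Fin.partialSum_succ]
    ring

lemma WΓ_le_VΓ : WΓ W ≤ VΓ B W := by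
  rintro v ⟨hW, g, D, hg, hD, h1, h2⟩
  have h : ∀ i, EqConstOn B i g 0 := fun i k hk => h1 k (B.kind_cs i k hk)
  exact ⟨hW, g, D, hg, hD, h 0, fun i _ => ⟨0, h i⟩, h2⟩

lemma gradH2_mem (hA3 : AssumptionA3 B W G) {v : P.H2} (hv : v ∈ WΓ W) : P.gradH2 v ∈ G :=
  (hA3.range_eq_ker ▸ Submodule.mem_map_of_mem (WΓ_le_VΓ hv) :
    P.gradH2 v ∈ G ⊓ LinearMap.ker P.rot).1

lemma constraint_gradH2 (hG : G ≤ P.ThetaΓ) {v : P.H2} (hv : v ∈ WΓ W) (hvG : P.gradH2 v ∈ G) :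
    constraint B hG ⟨P.gradH2 v, hvG⟩ = 0 := by
  rw [constraint_eq_zero_iff]
  refine ⟨rot_gradH2 v, fun i => ?_⟩
  obtain ⟨-, g, D, hg, hD, h1, h2⟩ := hv
  have h : ∀ i, EqConstOn B i g 0 := fun i k hk => h1 k (B.kind_cs i k hk)
  rw [flux_gradH2 B i (hG hvG) hg (h _) (h _), sub_zero]

/-- A rotation-free field without fluxes is the gradient of a function whose constant values on the
components of `Γ_cs` all agree with the value `0` on the first one. -/
lemma exists_gradH2_eq_of_constraint_eq_zero (hG : G ≤ P.ThetaΓ) (hA3 : AssumptionA3 B W G)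
    {θ : G} (hθ : constraint B hG θ = 0) : ∃ v ∈ WΓ W, P.gradH2 v = θ := by
  rw [constraint_eq_zero_iff] at hθ
  have hmem : (θ : P.H1v) ∈ (VΓ B W).map P.gradH2 := hA3.range_eq_ker ▸ ⟨θ.2, hθ.1⟩
  obtain ⟨v, ⟨hW, g, D, hg, hD, h0, hconst, hcl⟩, hv⟩ := hmem
  have hΘ : P.gradH2 v ∈ P.ThetaΓ := hv ▸ hG θ.2
  have hzero : ∀ i, EqConstOn B i g 0 := by
    intro i
    induction i using Fin.induction with
    | zero => exact h0
    | succ i ih =>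
      obtain ⟨c, hc⟩ := hconst i.succ (Fin.succ_ne_zero i)
      have h := flux_gradH2 B i hΘ hg ih hc
      rw [hv, hθ.2 i, sub_zero] at h
      exact h ▸ hc
  refine ⟨v, ⟨hW, g, D, hg, hD, fun k hk => ?_, hcl⟩, hv⟩
  obtain ⟨i, l, hl, rfl⟩ := B.exists_mem_Ico_of_ne_free hk
  exact hzero i l hl

lemma IsPlateForm.eq_zero_of_constraint_eq_zero {a : P.H1v →ₗ[ℝ] P.H1v →ₗ[ℝ] ℝ}
    (ha : IsPlateForm a) (hG : G ≤ P.ThetaΓ) (hA3 : AssumptionA3 B W G) (θ : G)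
    (hθ : constraint B hG θ = 0) (h : a θ θ = 0) : θ = 0 := by
  obtain ⟨v, hv, hvθ⟩ := exists_gradH2_eq_of_constraint_eq_zero hG hA3 hθ
  rw [← hvθ] at h
  refine Subtype.ext ?_
  rw [← hvθ, ha.eq_zero hv.2 h, map_zero]
  rfl

/-! ### The three discrete problems -/

/-- A load functional restricted to `𝕎̃_Γ`. -/
def loadWtₗ {Wt : Submodule ℝ P.H1} (F : P.loadSpace Wt →ₗ[ℝ] ℝ) : Wt →ₗ[ℝ] ℝ :=
  F ∘ₗ Submodule.inclusion le_sup_right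

variable {Wt : Submodule ℝ P.H1}

theorem existsUnique_isAlgorithmSolution [FiniteDimensional ℝ G] [FiniteDimensional ℝ Wt]
    {a : P.H1v →ₗ[ℝ] P.H1v →ₗ[ℝ] ℝ} (ha : IsPlateForm a) (hG : G ≤ P.ThetaΓ)
    (hWt : ∀ v ∈ Wt, ∀ c : ℝ,
      (∀ᵐ x ∂(volume.restrict P.domain), (v : P.L2) x = c) → c = 0)
    (hA1 : AssumptionA1 B W G) (hA3 : AssumptionA3 B W G) (F : P.loadSpace Wt →ₗ[ℝ] ℝ) :
    ∃! s : AlgorithmOutput m G Wt, IsAlgorithmSolution a B F s := by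
  have hgrad := LinearMap.existsUnique_of_definite
    (innerVₗ.compl₁₂ (P.grad ∘ₗ Wt.subtype) (P.grad ∘ₗ Wt.subtype))
    (fun v hv => eq_zero_of_innerV_grad hWt v hv)
  obtain ⟨z, hz, hzu⟩ := hgrad (loadWtₗ F)
  obtain ⟨⟨θ, x⟩, ⟨hθ, hθ0⟩, hθu⟩ := LinearMap.existsUnique_saddlePoint
    (a.compl₁₂ G.subtype G.subtype) (constraint B hG) (multiplierForm G m)
    (constraint_surjective hG hA1)
    (fun θ h h' => ha.eq_zero_of_constraint_eq_zero hG hA3 θ h h') multiplierForm_definite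
    (innerVₗ (P.grad z) ∘ₗ toL2vₗ ∘ₗ G.subtype)
  obtain ⟨w, hw, hwu⟩ := hgrad (innerVₗ (toL2v (θ : P.H1v)) ∘ₗ P.grad ∘ₗ Wt.subtype)
  have hθ0' := (constraint_eq_zero_iff B hG θ).1 hθ0
  refine ⟨⟨z, θ, x.1, x.2, w⟩, ⟨hz, fun ψ => ?_, fun q => ?_, fun μ => ?_, hw⟩, ?_⟩
  · rw [add_assoc]; exact hθ ψ
  · dsimp only
    rw [hθ0'.1, inner_zero_left]
  · simp [hθ0'.2]
  · rintro ⟨z', θ', r', κ', w'⟩ ⟨h1, h2, h3, h4, h5⟩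
    dsimp only at h1 h2 h3 h4 h5
    obtain rfl : z' = z := hzu _ h1
    have hc : constraint B hG θ' = 0 := by
      refine (constraint_eq_zero_iff B hG θ').2 ⟨?_, fun i => ?_⟩
      · exact inner_self_eq_zero.1 (h3 ⟨_, Submodule.mem_map_of_mem θ'.2⟩)
      · simpa [Pi.single_apply] using h4 (Pi.single i 1)
    have hp : ((θ', (r', κ')) : G × (G.map P.rot × (Fin m → ℝ))) = (θ, x) :=
      hθu _ ⟨fun ψ => (add_assoc _ _ _).symm.trans (h2 ψ), hc⟩
    obtain ⟨rfl, rfl⟩ := Prod.ext_iff.1 hp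
    obtain rfl : w' = w := hwu _ h5
    rfl

/-- The load functional restricted to `𝕎_Γ`. -/
def loadWΓ (W : Submodule ℝ P.H2) (F : P.loadSpace Wt →ₗ[ℝ] ℝ) : WΓ W →ₗ[ℝ] ℝ where
  toFun v := loadH2 F ⟨v, v.2.2⟩
  map_add' u v := F.map_add ⟨((u : P.H2) : P.H1), _⟩ ⟨((v : P.H2) : P.H1), _⟩
  map_smul' c v := F.map_smul c ⟨((v : P.H2) : P.H1), _⟩

theorem existsUnique_isGalerkin [FiniteDimensional ℝ Wt]
    {a : P.H1v →ₗ[ℝ] P.H1v →ₗ[ℝ] ℝ} (ha : IsPlateForm a) (hA2 : AssumptionA2 W Wt)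
    (F : P.loadSpace Wt →ₗ[ℝ] ℝ) : ∃! w : WΓ W, IsGalerkin a W F w := by
  -- Provided by hand, as instance search times out on it.
  let _ : AddCommGroup (WΓ W) := (WΓ W).addCommGroup
  let ι : WΓ W →ₗ[ℝ] Wt :=
    (P.H2.subtype ∘ₗ (WΓ W).subtype).codRestrict Wt fun v => hA2 v v.2
  have hι : Function.Injective ι := fun u v h =>
    Subtype.ext (Subtype.ext (congrArg (fun x : Wt => (x : P.H1)) h))
  have : FiniteDimensional ℝ (WΓ W) := FiniteDimensional.of_injective ι hι
  let D : WΓ W →ₗ[ℝ] P.H1v := P.gradH2.domRestrict (WΓ W)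
  exact LinearMap.existsUnique_of_definite (V := WΓ W) (a.compl₁₂ D D)
    (fun v hv => Subtype.ext (ha.eq_zero v.2.2 hv)) (loadWΓ W F)

/-- The gradient of the Galerkin approximation satisfies the equation for `θ_X` tested with
constraint-free fields, since these are gradients of functions in `𝕎_Γ ⊆ 𝕎̃_Γ`; hence it is
`θ_X`, and the last step recovers its potential. -/
theorem IsAlgorithmSolution.eq_galerkin
    {a : P.H1v →ₗ[ℝ] P.H1v →ₗ[ℝ] ℝ} (ha : IsPlateForm a) (hG : G ≤ P.ThetaΓ)
    (hWt : ∀ v ∈ Wt, ∀ c : ℝ,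
      (∀ᵐ x ∂(volume.restrict P.domain), (v : P.L2) x = c) → c = 0)
    (hA2 : AssumptionA2 W Wt) (hA3 : AssumptionA3 B W G) {F : P.loadSpace Wt →ₗ[ℝ] ℝ}
    {s : AlgorithmOutput m G Wt} {w : WΓ W} (hs : IsAlgorithmSolution a B F s)
    (hw : IsGalerkin a W F w) :
    P.grad (s.w : P.H1) = toL2v (s.θ : P.H1v) ∧ (s.w : P.H1) = ((w : P.H2) : P.H1) := by
  have hsc : constraint B hG s.θ = 0 := by
    refine (constraint_eq_zero_iff B hG s.θ).2 ⟨?_, fun i => ?_⟩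
    · exact inner_self_eq_zero.1 (hs.rot_free ⟨_, Submodule.mem_map_of_mem s.θ.2⟩)
    · simpa [Pi.single_apply] using hs.flux_free (Pi.single i 1)
  obtain ⟨u, hu, huθ⟩ := exists_gradH2_eq_of_constraint_eq_zero hG hA3 hsc
  have huG : ∀ v ∈ WΓ W, a (P.gradH2 u) (P.gradH2 v) = innerV (P.grad s.z) (P.grad (v : P.H1)) := by
    intro v hv
    have h1 := hs.stokes ⟨P.gradH2 v, gradH2_mem hA3 hv⟩
    have h2 := (constraint_eq_zero_iff B hG _).1 (constraint_gradH2 hG hv (gradH2_mem hA3 hv))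
    simpa [h2.1, h2.2, ← huθ, toL2v_gradH2] using h1
  -- `∇u` and `∇w` solve the same problem on `∇𝕎_Γ`, by the first step and (A2).
  have hudiff : u = w := by
    have hd : u - w ∈ WΓ W := sub_mem hu w.2
    refine sub_eq_zero.1 (ha.eq_zero hd.2 ?_)
    have h1 := huG _ hd
    have h2 := hw ⟨_, hd⟩
    have h3 : innerV (P.grad s.z) (P.grad ((u - w : P.H2) : P.H1)) = loadH2 F ⟨u - w, hd.2⟩ :=
      hs.preprocess ⟨_, hA2 _ hd⟩
    dsimp only at h2
    have h4 : a (P.gradH2 (u - w)) = a (P.gradH2 u) - a (P.gradH2 w) := by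
      rw [map_sub, map_sub]
    rw [h4, LinearMap.sub_apply, h1, h2, h3, sub_self]
  subst hudiff
  have hsw : s.w = ⟨_, hA2 w w.2⟩ := by
    refine sub_eq_zero.1 (eq_zero_of_innerV_grad hWt _ ?_)
    have h := hs.postprocess (s.w - ⟨_, hA2 w w.2⟩)
    rw [← huθ, toL2v_gradH2] at h
    rw [← innerVₗ_apply] at h ⊢
    rw [← innerVₗ_apply] at h
    conv_lhs => enter [1]; rw [Submodule.coe_sub, map_sub]
    rw [map_sub, LinearMap.sub_apply, h, sub_self]
  rw [hsw, ← huθ]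
  exact ⟨rfl, rfl⟩

end PolygonalPlate

end

theorem mainTheorem1 (P : PolygonalPlate) {m : ℕ} (B : P.BoundaryArcs m)
    (a : P.H1v →ₗ[ℝ] P.H1v →ₗ[ℝ] ℝ) (ha : PolygonalPlate.IsPlateForm a)
    (W : Submodule ℝ P.H2) (G : Submodule ℝ P.H1v) (Wt : Submodule ℝ P.H1)
    [FiniteDimensional ℝ G] [FiniteDimensional ℝ Wt]
    (hG : G ≤ P.ThetaΓ)
    (hWt : ∀ v ∈ Wt, ∀ c : ℝ,
      (∀ᵐ x ∂(MeasureTheory.volume.restrict P.domain), (v : P.L2) x = c) → c = 0)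
    (hA1 : PolygonalPlate.AssumptionA1 B W G)
    (hA2 : PolygonalPlate.AssumptionA2 W Wt)
    (hA3 : PolygonalPlate.AssumptionA3 B W G)
    (F : P.loadSpace Wt →ₗ[ℝ] ℝ)
    (hF : ∃ C : ℝ, ∀ v : P.H2Γ,
      |PolygonalPlate.loadH2 F v| ≤ C * PolygonalPlate.normH2 (v : P.H2)) :
    (∃! s : PolygonalPlate.AlgorithmOutput m G Wt, PolygonalPlate.IsAlgorithmSolution a B F s) ∧
    (∃! w : PolygonalPlate.WΓ W, PolygonalPlate.IsGalerkin a W F w) ∧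
    ∀ (s : PolygonalPlate.AlgorithmOutput m G Wt) (w : PolygonalPlate.WΓ W),
      PolygonalPlate.IsAlgorithmSolution a B F s → PolygonalPlate.IsGalerkin a W F w →
        P.grad (s.w : P.H1) = PolygonalPlate.toL2v (s.θ : P.H1v) ∧
        (s.w : P.H1) = ((w : P.H2) : P.H1) := by
  exact ⟨PolygonalPlate.existsUnique_isAlgorithmSolution ha hG hWt hA1 hA3 F,
    PolygonalPlate.existsUnique_isGalerkin ha hA2 F,
    fun _ _ hs hw => hs.eq_galerkin ha hG hWt hA2 hA3 hw⟩
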